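/- **Networks.** Let $\sigma(u)=\max\{u,0\}$. For a filter $w=(w_0,\dots,w_s)$ let $T^w=(w_{i-k})$ be the $(D+s)\times D$ Toeplitz matrix of convolution with $w$ (with $w_j=0$ for $j\notin\{0,\dots,s\}$). For integers $d,s,J_1,N\ge 1$ put $d_0=d$, $d_{J_1}=\lfloor (d+J_1s)/d\rfloor$, $J_2=J_1+\lceil (2N+3)d_{J_1}/(s-1)\rceil$, and $d_j=d_{j-1}+s$ for all other $j\le J_2$. A DCNN has the layers $h^{(0)}(x)=x$, $h^{(j)}=\sigma(T^{w^{(j)}}h^{(j-1)}-b^{(j)})$ for $1\le j\le J_2$, where for $j=J_1$ the result $(v_i)_{i=1}^{d+J_1s}$ is downsampled to $(v_{id})_{i=1}^{d_{J_1}}$, and $h^{(J_2+1)}=\sigma(F h^{(J_2)}-b^{(J_2+1)})\in\mathbb R^{2N+3}$ with a matrix $F$ of identical rows; the biases satisfy $(b^{(j)})_{s+1}=\dots=(b^{(j)})_{d_{j-1}}$ for $1\le j\le J_2-1$. Its output is $c\cdot h^{(J_2+1)}$ with $c\in\mathbb R^{2N+3}$. **Prescribed parts.** Let $n_q=\binom{d-1+q}{q}$,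 $J_1=\lceil (n_qd-1)/(s-1)\rceil$, and $t_j=-1+\frac{j-2}{N}$ for $1\le j\le 2N+3$. For $\zeta=(\zeta_i)_{i=2}^{2N+2}$, extended by $0$, let $\mathcal L_N(\zeta)=(\zeta_{i-1}-2\zeta_i+\zeta_{i+1})_{i=1}^{2N+3}$, and let $v^{[\ell]}=\mathcal L_N((t_i^\ell)_{i=2}^{2N+2})$. Consider DCNNs in which: * the filters $w^{(J_1+1)},\dots,w^{(J_2)}$ satisfy $w^{(J_2)}*\dots*w^{(J_1+1)}=W^{[1]}$, where $W^{[1]}$ is $1$ at $0,d_{J_1},2d_{J_1},\dots,(2N+3)d_{J_1}$ and $0$ elsewhere (such filters exist, and any choice may be fixed in advance, independently of $Q$ and $f$); * every row of $F$ is $\beta F^{(N)}$ for some $\beta=(\beta_{k,\ell})_{1\le k\le n_q,\,1\le\ell\le q}$, where the row $(\ell,k)$ of $F^{(N)}$ has the entry $Nv^{[\ell]}_j$ in the column $(j-1)d_{J_1}+k$ for $1\le j\le 2N+3$, and $0$ elsewhere; * $b^{(J_2+1)}=-Q_0\mathbf 1+\widehat B\,(t_1,\dots,t_{2N+3})^T$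 and $c=\frac N{\widehat B}\mathcal L_N(\zeta)$ with $Q_0,\widehat B\in\mathbb R$ and $\zeta\in\mathbb R^{2N+1}$. The free parameters are the $s+1$ entries of each of $w^{(1)},\dots,w^{(J_1)}$, the $2s+1$ numbers that determine each restricted $b^{(j)}$, $1\le j\le J_2-1$, the $d_{J_2}$ entries of $b^{(J_2)}$, the $qn_q$ entries of $\beta$, the numbers $Q_0$ and $\widehat B$, and the $2N+1$ entries of $\zeta$. Let $\mathcal N$ be their total number. **Theorem.** Let $Q$ be a real polynomial in $d$ variables. There are constants $\widehat B_Q>0$, depending only on $Q$, and $C_{Q,\alpha}>0$, depending only on $Q$ and $\alpha$, such that the following holds. Let $2\le s\le d$, let $q\ge1$ with $\deg Q\le q$, let $\Omega\subseteq\{x\in\mathbb R^d:|x|\le1\}$ and $B_Q=\sup_\Omega|Q|$, let $0<\alpha\le1$ and let $f$ be Lipschitz-$\alpha$ on $[-B_Q,B_Q]$, with seminorm $|f|_{C^{0,\alpha}}=\sup_{u\ne v}|f(u)-f(v)|/|u-v|^\alpha$ and maximum norm $\|f\|_\infty$ there. 1. For every integer $N\ge1$ there is a network as above, with $Q_0=Q(0)$,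 $\widehat B=\widehat B_Q$ and with $\beta$ such that $Q(x)=Q(0)+\sum_{k,\ell}\beta_{k,\ell}(\xi_k\cdot x)^\ell$ on $\mathbb R^d$ for some unit vectors $\xi_1,\dots,\xi_{n_q}\in\mathbb R^d$, such that $$\|c\|_\infty\le\frac{4\|f\|_\infty N}{\widehat B_Q},\qquad \sup_{x\in\Omega}\bigl|c\cdot h^{(J_2+1)}(x)-f(Q(x))\bigr|\le\frac{C_{Q,\alpha}|f|_{C^{0,\alpha}}}{N^\alpha},$$ and the number of free parameters satisfies $$\mathcal N\le(30+28n_q)N+(8d+q+44)n_q+4s+49.$$ 2. For every $0<\varepsilon\le1$, with $N=\max\bigl\{1,\bigl\lceil C_{Q,\alpha}^{1/\alpha}|f|_{C^{0,\alpha}}^{1/\alpha}\varepsilon^{-1/\alpha}\bigr\rceil\bigr\}$, there is such a network with uniform error at most $\varepsilon$ on $\Omega$ (and the same bound on $\|c\|_\infty$), and $$\mathcal N\le\bigl(C_{Q,\alpha,|f|}+8d\bigr)\,d^{\,q}\,\varepsilon^{-1/\alpha},\qquad C_{Q,\alpha,|f|}=43\bigl(C_{Q,\alpha}^{1/\alpha}|f|_{C^{0,\alpha}}^{1/\alpha}+1\bigr)+q+73.$$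 -/

import Mathlib

noncomputable section

namespace DCNNApprox

/-! Vectors of length `D` are functions on `Fin D`; indices start at `0`, so the entry written
`v_i` with `1 ≤ i ≤ D` in one-based notation is `v (i - 1)` here. -/

/-- The rectified linear unit. -/
def relu (u : ℝ) : ℝ := max u 0

/-- A filter `(w_0, …, w_s)` as a sequence supported in `{0, …, s}`. -/
def filterSeq {s : ℕ} (w : Fin (s + 1) → ℝ) (n : ℕ) : ℝ :=
  if h : n < s + 1 then w ⟨n, h⟩ else 0

/-- Convolution of two sequences supported in the nonnegative integers. -/
def convSeq (u v : ℕ → ℝ) (i : ℕ) : ℝ :=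
  ∑ k ∈ Finset.range (i + 1), u (i - k) * v k

/-- The iterated convolution `w (j-1) * ⋯ * w 1 * w 0` of the first `j` filters
(the delta sequence for `j = 0`). -/
def convProd {s J : ℕ} (w : Fin J → Fin (s + 1) → ℝ) : (j : ℕ) → j ≤ J → ℕ → ℝ
  | 0, _ => fun i => if i = 0 then 1 else 0
  | j + 1, h => convSeq (filterSeq (w ⟨j, h⟩)) (convProd w j (Nat.le_of_succ_le h))

/-- The convolutional (Toeplitz type) matrix `T^w = (w_{i-k})` of size `(D + s) × D`. -/
def toeplitz (D : ℕ) {s : ℕ} (w : Fin (s + 1) → ℝ) : Matrix (Fin (D + s)) (Fin D) ℝ :=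
  fun i k => if (k : ℕ) ≤ (i : ℕ) then filterSeq w ((i : ℕ) - (k : ℕ)) else 0

/-- The width after `j` convolutional layers of filter length `s` on inputs of width `D`. -/
def convWidth (D s j : ℕ) : ℕ := D + j * s

theorem convWidth_zero (D s : ℕ) : D = convWidth D s 0 := by simp [convWidth]

theorem convWidth_succ (D s j : ℕ) : convWidth D s (j + 1) = convWidth D s j + s := by
  simp [convWidth, Nat.succ_mul, Nat.add_assoc]

/-- The first `j` layers `h ↦ σ(T h - b)` of a group of `J` convolutional layers on `ℝ^D`. -/
def convStack {D s J : ℕ} (w : Fin J → Fin (s + 1) → ℝ)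
    (b : (j : Fin J) → Fin (convWidth D s (j : ℕ) + s) → ℝ) (x : Fin D → ℝ) :
    (j : ℕ) → j ≤ J → Fin (convWidth D s j) → ℝ
  | 0, _ => fun i => x (Fin.cast (convWidth_zero D s).symm i)
  | j + 1, h => fun i =>
      relu ((toeplitz (convWidth D s j) (w ⟨j, h⟩)).mulVec
        (convStack w b x j (Nat.le_of_succ_le h)) (Fin.cast (convWidth_succ D s j) i)
        - b ⟨j, h⟩ (Fin.cast (convWidth_succ D s j) i))

theorem downsample_aux {d m : ℕ} (i : Fin (m / d)) : ((i : ℕ) + 1) * d - 1 < m := by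
  have hi := i.isLt
  rcases Nat.eq_zero_or_pos d with h | h
  · subst h
    simp at hi
  · have h1 : ((i : ℕ) + 1) * d ≤ m := (Nat.le_div_iff_mul_le h).1 hi
    have h2 : 0 < ((i : ℕ) + 1) * d := Nat.mul_pos (Nat.succ_pos _) h
    omega

/-- The downsampling operator `v ↦ (v_d, v_{2d}, v_{3d}, …)` (one-based indices). -/
def downsample (d : ℕ) {m : ℕ} (v : Fin m → ℝ) : Fin (m / d) → ℝ :=
  fun i => v ⟨((i : ℕ) + 1) * d - 1, downsample_aux i⟩

/-- The restriction `b_{s+1} = b_{s+2} = ⋯ = b_D` (one-based indices) on a bias vector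
of a convolutional layer from width `D` to width `D + s`. -/
def BiasRestricted (D : ℕ) {s : ℕ} (b : Fin (D + s) → ℝ) : Prop :=
  ∀ i i' : Fin (D + s), s ≤ (i : ℕ) → (i : ℕ) < D → s ≤ (i' : ℕ) → (i' : ℕ) < D → b i = b i'

/-- The width `d_{J₁} = ⌊(d + J₁ s) / d⌋` after the first group and the downsampling. -/
def midWidth (d s J₁ : ℕ) : ℕ := convWidth d s J₁ / d

/-- The number `J₂ - J₁ = ⌈(2N+3) d_{J₁} / (s-1)⌉` of layers in the second group. -/
def secondDepth (d s J₁ N : ℕ) : ℕ :=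
  ⌈((2 * N + 3 : ℚ) * (midWidth d s J₁ : ℚ)) / ((s : ℚ) - 1)⌉₊

/-- The width `d_{J₂}` of the last convolutional layer. -/
def topWidth (d s J₁ N : ℕ) : ℕ := convWidth (midWidth d s J₁) s (secondDepth d s J₁ N)

/-- A downsampled deep convolutional network on `ℝ^d` with structural parameters `J₁ ≥ 1` and `N`:
`J₁` convolutional layers, downsampling, `J₂ - J₁` further convolutional layers, and a fully
connected layer of width `2N + 3` whose connection matrix has identical rows. The bias vectors of
all convolutional layers but the last are restricted. -/
structure DCNN (d s J₁ N : ℕ) where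
  w₁ : Fin J₁ → Fin (s + 1) → ℝ
  b₁ : (j : Fin J₁) → Fin (convWidth d s (j : ℕ) + s) → ℝ
  w₂ : Fin (secondDepth d s J₁ N) → Fin (s + 1) → ℝ
  b₂ : (j : Fin (secondDepth d s J₁ N)) → Fin (convWidth (midWidth d s J₁) s (j : ℕ) + s) → ℝ
  F : Matrix (Fin (2 * N + 3)) (Fin (topWidth d s J₁ N)) ℝ
  bOut : Fin (2 * N + 3) → ℝ
  b₁_restricted : ∀ j : Fin J₁, BiasRestricted (convWidth d s (j : ℕ)) (b₁ j)
  b₂_restricted : ∀ j : Fin (secondDepth d s J₁ N), (j : ℕ) + 1 < secondDepth d s J₁ N →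
    BiasRestricted (convWidth (midWidth d s J₁) s (j : ℕ)) (b₂ j)
  F_rows : ∀ i i', F i = F i'

namespace DCNN

variable {d s J₁ N : ℕ}

/-- `h^{(J₁)}(x)`, after downsampling. -/
def midLayer (net : DCNN d s J₁ N) (x : Fin d → ℝ) : Fin (midWidth d s J₁) → ℝ :=
  downsample d (convStack net.w₁ net.b₁ x J₁ le_rfl)

/-- `h^{(J₂)}(x)`. -/
def topLayer (net : DCNN d s J₁ N) (x : Fin d → ℝ) : Fin (topWidth d s J₁ N) → ℝ :=
  convStack net.w₂ net.b₂ (net.midLayer x) (secondDepth d s J₁ N) le_rfl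

/-- `h^{(J₂+1)}(x)`, the fully connected layer. -/
def lastLayer (net : DCNN d s J₁ N) (x : Fin d → ℝ) : Fin (2 * N + 3) → ℝ :=
  fun i => relu (net.F.mulVec (net.topLayer x) i - net.bOut i)

end DCNN

/-! ### The explicitly prescribed parts of the network -/

/-- `n_q = binom(d - 1 + q, q)`, the dimension of the homogeneous polynomials of degree `q`. -/
def featureCount (d q : ℕ) : ℕ := (d - 1 + q).choose q

/-- `J₁ = ⌈(n_q d - 1) / (s - 1)⌉`. -/
def firstDepth (d s q : ℕ) : ℕ :=
  ⌈((featureCount d q : ℚ) * (d : ℚ) - 1) / ((s : ℚ) - 1)⌉₊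

/-- The sequence with value `1` at `k D`, `0 ≤ k ≤ 2N+3`, and `0` elsewhere (for `D ≥ 1`). -/
def spikeSeq (D N : ℕ) (i : ℕ) : ℝ := if D ∣ i ∧ i ≤ (2 * N + 3) * D then 1 else 0

/-- The prescribed filters of the second group: they factor the spike sequence with spacing
`d_{J₁}` under convolution. No parameter is involved. -/
def IsSpikeFactorization {d s J₁ N : ℕ} (w : Fin (secondDepth d s J₁ N) → Fin (s + 1) → ℝ) :
    Prop :=
  convProd w (secondDepth d s J₁ N) le_rfl = spikeSeq (midWidth d s J₁) N

/-- The knots `t_j = -1 + (j - 2) / N`, `1 ≤ j ≤ 2N+3` (one-based indices). -/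
def knot (N : ℕ) (i : Fin (2 * N + 3)) : ℝ := -1 + ((i : ℝ) - 1) / (N : ℝ)

/-- The second difference operator `ℝ^{2N+1} → ℝ^{2N+3}`, `ζ` being extended by zero; entry `m`
of `ζ` belongs to the knot `-1 + m / N`. -/
def secondDiff (N : ℕ) (ζ : Fin (2 * N + 1) → ℝ) (i : Fin (2 * N + 3)) : ℝ :=
  let e : ℤ → ℝ := fun m =>
    if h : 0 ≤ m ∧ m.toNat < 2 * N + 1 then ζ ⟨m.toNat, h.2⟩ else 0
  e ((i : ℤ) - 2) - 2 * e ((i : ℤ) - 1) + e (i : ℤ)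

/-- The vector `v^{[ℓ]}`, the second difference of the values of `u ↦ u^ℓ` at the inner knots. -/
def powerDiff (N ℓ : ℕ) : Fin (2 * N + 3) → ℝ :=
  secondDiff N fun m => (-1 + (m : ℝ) / (N : ℝ)) ^ ℓ

/-- The matrix `F^{(N)}` with rows indexed by `(ℓ, k)` (the exponent being `ℓ + 1`) and `m`
columns: its `j`-th block of `D` columns is `N v^{[ℓ]}_j [I_n O]`, and columns beyond the first
`2N+3` blocks vanish. -/
def splineMatrix (N q n D m : ℕ) : Matrix (Fin q × Fin n) (Fin m) ℝ :=
  fun r c =>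
    if h : (c : ℕ) / D < 2 * N + 3 ∧ (c : ℕ) % D = (r.2 : ℕ) then
      (N : ℝ) * powerDiff N ((r.1 : ℕ) + 1) ⟨(c : ℕ) / D, h.1⟩
    else 0

/-! ### Free parameters -/

/-- The bias vector of a layer from width `D` to width `D + s` given by `2s + 1` numbers:
the first `s` entries, the common value of the middle entries, the last `s` entries. -/
def spreadBias (D : ℕ) {s : ℕ} (p : Fin (2 * s + 1) → ℝ) (i : Fin (D + s)) : ℝ :=
  if h : (i : ℕ) < s then p ⟨(i : ℕ), by omega⟩
  else if h' : (i : ℕ) < D then p ⟨s, by omega⟩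
  else p ⟨s + 1 + ((i : ℕ) - D), by
    have := i.isLt
    omega⟩

theorem spreadBias_restricted (D : ℕ) {s : ℕ} (p : Fin (2 * s + 1) → ℝ) :
    BiasRestricted D (spreadBias D p) := by
  intro i i' h1 h2 h3 h4
  simp [spreadBias, Nat.not_lt.2 h1, Nat.not_lt.2 h3, h2, h4]

/-- The free parameters of the networks of the construction, one index for each real number:
the filters and the restricted biases of the first group, the restricted biases of the second
group, the bias of its last layer, the coefficients `β` and the numbers `Q(0)` and `B̂` in the
fully connected layer, and `2N + 1` values determining the output coefficients. -/
inductive FreeIndex (d s q N : ℕ) : Type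
  | filter (j : Fin (firstDepth d s q)) (k : Fin (s + 1))
  | bias₁ (j : Fin (firstDepth d s q)) (k : Fin (2 * s + 1))
  | bias₂ (j : Fin (secondDepth d s (firstDepth d s q) N - 1)) (k : Fin (2 * s + 1))
  | topBias (i : Fin (topWidth d s (firstDepth d s q) N))
  | ridge (ℓ : Fin q) (k : Fin (featureCount d q))
  | const
  | scale
  | sample (m : Fin (2 * N + 1))

/-- The number of free parameters. -/
def freeCount (d s q N : ℕ) : ℕ := Nat.card (FreeIndex d s q N)

/-- The network with second-group filters `w₂` and free parameters `θ`. Its connection matrix has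
all rows equal to `β F^{(N)}`, and the last bias vector is `-Q(0) 1 + B̂ (t_1, …, t_{2N+3})`. -/
def buildNet {d s q N : ℕ}
    (w₂ : Fin (secondDepth d s (firstDepth d s q) N) → Fin (s + 1) → ℝ)
    (θ : FreeIndex d s q N → ℝ) : DCNN d s (firstDepth d s q) N where
  w₁ := fun j k => θ (.filter j k)
  b₁ := fun j => spreadBias (convWidth d s (j : ℕ)) fun k => θ (.bias₁ j k)
  w₂ := w₂
  b₂ := fun j =>
    if h : (j : ℕ) + 1 < secondDepth d s (firstDepth d s q) N then
      spreadBias (convWidth (midWidth d s (firstDepth d s q)) s (j : ℕ))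
        fun k => θ (.bias₂ ⟨(j : ℕ), by omega⟩ k)
    else fun i => θ (.topBias ⟨(i : ℕ), by
      have hj : (j : ℕ) + 1 = secondDepth d s (firstDepth d s q) N := by
        have := j.isLt
        omega
      exact lt_of_lt_of_eq i.isLt
        ((convWidth_succ _ s _).symm.trans (congrArg (convWidth _ s) hj))⟩)
  F := fun _ =>
    Matrix.vecMul (fun r : Fin q × Fin (featureCount d q) => θ (.ridge r.1 r.2))
      (splineMatrix N q (featureCount d q) (midWidth d s (firstDepth d s q))
        (topWidth d s (firstDepth d s q) N))
  bOut := fun i => -θ .const + θ .scale * knot N i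
  b₁_restricted := fun _ => spreadBias_restricted _ _
  b₂_restricted := by
    intro j h
    simp only [h, dif_pos]
    exact spreadBias_restricted _ _
  F_rows := fun _ _ => rfl

/-- The output coefficient vector `c = (N / B̂) L_N(ζ)` determined by the free parameters. -/
def outCoeff {d s q N : ℕ} (θ : FreeIndex d s q N → ℝ) : Fin (2 * N + 3) → ℝ :=
  fun i => (N : ℝ) / θ .scale * secondDiff N (fun m => θ (.sample m)) i

/-! ### Norms and the approximation property -/

/-- `B_Q = sup_{x ∈ Ω} |Q(x)|`. -/
def polySup {d : ℕ} (Q : MvPolynomial (Fin d) ℝ) (Ω : Set (EuclideanSpace ℝ (Fin d))) : ℝ :=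
  sSup ((fun x : EuclideanSpace ℝ (Fin d) => |MvPolynomial.eval (fun i => x i) Q|) '' Ω)

/-- `‖f‖_∞` on `[-B, B]`. -/
def supNorm (f : ℝ → ℝ) (B : ℝ) : ℝ := sSup ((fun u => |f u|) '' Set.Icc (-B) B)

/-- The difference quotients whose supremum is the Lipschitz-`α` seminorm on `[-B, B]`. -/
def holderQuotients (f : ℝ → ℝ) (B α : ℝ) : Set ℝ :=
  {r | ∃ u ∈ Set.Icc (-B) B, ∃ v ∈ Set.Icc (-B) B, u ≠ v ∧ r = |f u - f v| / |u - v| ^ α}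

/-- `f ∈ C^{0,α}[-B, B]`. -/
def MemHolder (f : ℝ → ℝ) (B α : ℝ) : Prop := BddAbove (holderQuotients f B α)

/-- The seminorm `|f|_{C^{0,α}}` on `[-B, B]`. -/
def holderSeminorm (f : ℝ → ℝ) (B α : ℝ) : ℝ := sSup (holderQuotients f B α)

/-- `θ` has the prescribed values in the fully connected layer: `B̂`, `Q(0)`, and coefficients
`β` that represent `Q` by powers of linear forms with unit vectors,
`Q(x) = Q(0) + ∑_k ∑_ℓ β_{k,ℓ} (ξ_k · x)^ℓ`. -/
def IsAdapted {d s q N : ℕ} (Q : MvPolynomial (Fin d) ℝ) (Bhat : ℝ)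
    (θ : FreeIndex d s q N → ℝ) : Prop :=
  θ .scale = Bhat ∧ θ .const = MvPolynomial.eval (fun _ => 0) Q ∧
  ∃ ξ : Fin (featureCount d q) → EuclideanSpace ℝ (Fin d), (∀ k, ‖ξ k‖ = 1) ∧
    ∀ x : EuclideanSpace ℝ (Fin d), MvPolynomial.eval (fun i => x i) Q =
      MvPolynomial.eval (fun _ => 0) Q +
        ∑ k, ∑ ℓ : Fin q, θ (.ridge ℓ k) * (inner ℝ (ξ k) x) ^ ((ℓ : ℕ) + 1)

/-- The network of structural parameter `N` reaches accuracy `δ` for `f ∘ Q` on `Ω`: the filters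
prescribed for the second group exist, and with any such filters there are free parameters, with
prescribed fully connected layer, for which the output `c · h^{(J₂+1)}` satisfies
`‖c‖_∞ ≤ 4 ‖f‖_∞ N / B̂` and is uniformly within `δ` of `f ∘ Q`. -/
def ReachesAccuracy {d : ℕ} (s q N : ℕ) (Q : MvPolynomial (Fin d) ℝ)
    (Ω : Set (EuclideanSpace ℝ (Fin d))) (f : ℝ → ℝ) (Bhat δ : ℝ) : Prop :=
  (∃ w₂ : Fin (secondDepth d s (firstDepth d s q) N) → Fin (s + 1) → ℝ,
    IsSpikeFactorization w₂) ∧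
  ∀ w₂ : Fin (secondDepth d s (firstDepth d s q) N) → Fin (s + 1) → ℝ,
    IsSpikeFactorization w₂ →
    ∃ θ : FreeIndex d s q N → ℝ, IsAdapted Q Bhat θ ∧
      (∀ i, |outCoeff θ i| ≤ 4 * supNorm f (polySup Q Ω) * (N : ℝ) / Bhat) ∧
      ∀ x ∈ Ω, |(∑ i, outCoeff θ i * (buildNet w₂ θ).lastLayer (fun i => x i) i)
        - f (MvPolynomial.eval (fun i => x i) Q)| ≤ δ

end DCNNApprox

end

/-!
The network is a composition of three explicit steps, and the approximation error comes only from
linear spline interpolation.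

*Ridge representation.* There are `n_q` unit vectors `ξ_k` at which no nonzero form of degree `q`
vanishes simultaneously (`exists_unisolvent`). By duality, the powers `(ξ_k · x) ^ ℓ` then span
the forms of every degree `ℓ ≤ q` (`mem_span_linForm_pow`), so that
`Q = Q(0) + ∑ β_{k,ℓ} (ξ_k · x) ^ ℓ`. The representation is taken for `q = deg Q` and padded by zero
coefficients, which makes all constants independent of `q`.

*Convolutional layers.* Real polynomials split into factors of degree at most two, hence any
sequence supported in `{0, …, A}` is a convolution of `J` filters of length `s` as soon as
`A ≤ J (s - 1)` (`exists_convProd_eq`). Biases that keep every layer nonnegative on the unit ball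
are compatible with the restriction, because the row sums of a convolutional matrix are constant in
the middle rows; with them the layers are affine (`convStack_affine`). The first group therefore
produces the numbers `ξ_k · x` after downsampling (`convSeq_ridgeSeq`), the second group repeats
them `2N + 3` times (`convSeq_spikeSeq`), and its last layer, whose bias is free, turns the copies
into `σ(ξ_k · x - t_j)` (`exists_parameters`).

*Splines.* On `[-1, 1]` the sum `∑_j N L_N(ζ)_j σ(u - t_j)` is the linear spline with values `ζ`
at the inner knots (`abs_spline_sub_le`). It is used twice: for the powers `u ^ ℓ`, which gives a
function bounded by `B̂` and within `K / N` of `Q`, and for `u ↦ f (B̂ u)`, with `f`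
extended by constants beyond `[-B_Q, B_Q]`. The total error is the variation of `f` over
a distance `(B̂ + K) / N`, so that `C_{Q,α} = (B̂ + K) ^ α` (`reachesAccuracy_of_ridge`).

The parameter count is arithmetic with the two ceilings and the floor that define the depths and
the intermediate width (`freeCount_le`).
-/

noncomputable section

namespace DCNNApprox

/-! ### Factorization of filters -/

theorem mk_convSeq (u v : ℕ → ℝ) :
    PowerSeries.mk (convSeq u v) = PowerSeries.mk u * PowerSeries.mk v := by
  ext i
  rw [mul_comm, PowerSeries.coeff_mul, Finset.Nat.sum_antidiagonal_eq_sum_range_succ_mk]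
  simp [convSeq, mul_comm]

theorem convSeq_assoc (u v x : ℕ → ℝ) : convSeq (convSeq u v) x = convSeq u (convSeq v x) := by
  have h : PowerSeries.mk (convSeq (convSeq u v) x) = PowerSeries.mk (convSeq u (convSeq v x)) := by
    simp only [mk_convSeq, mul_assoc]
  ext i
  simpa using congrArg (PowerSeries.coeff i) h

open Polynomial in
/-- Since irreducible real polynomials have degree at most two, the degrees of the divisors of a
real polynomial leave no gap of two consecutive numbers. -/
theorem exists_dvd_natDegree_between (P : ℝ[X]) (hP : P ≠ 0) (m : ℕ) (hm : m ≤ P.natDegree) :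
    ∃ g : ℝ[X], g ∣ P ∧ m ≤ g.natDegree ∧ g.natDegree ≤ m + 1 := by
  induction m with
  | zero => exact ⟨1, one_dvd _, by simp, by simp⟩
  | succ m ih =>
    obtain ⟨g, ⟨h, rfl⟩, h1, h2⟩ := ih (by omega)
    rcases Nat.lt_or_ge m g.natDegree with h3 | h3
    · exact ⟨g, ⟨h, rfl⟩, by omega, by omega⟩
    · have hg : g ≠ 0 := left_ne_zero_of_mul hP
      have hh : h ≠ 0 := right_ne_zero_of_mul hP
      rw [natDegree_mul hg hh] at hm
      have hu : ¬ IsUnit h := fun hu => by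
        have := natDegree_eq_zero_of_isUnit hu
        omega
      obtain ⟨f, hf, k, rfl⟩ := WfDvdMonoid.exists_irreducible_factor hu hh
      have h4 := hf.natDegree_pos
      have h5 := hf.natDegree_le_two
      refine ⟨g * f, ⟨k, by ring⟩, ?_, ?_⟩ <;> rw [natDegree_mul hg hf.ne_zero] <;> omega

open Polynomial in
/-- One factor of degree `s - 1` or `s` is split off at a time. -/
theorem exists_prod_natDegree_le {s : ℕ} (hs : 2 ≤ s) (J : ℕ) (P : ℝ[X])
    (hP : P.natDegree ≤ (J + 1) * (s - 1)) :
    ∃ p : ℕ → ℝ[X], (∀ j, (p j).natDegree ≤ s) ∧ ∏ j ∈ Finset.range (J + 1), p j = P := by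
  induction J generalizing P with
  | zero =>
    exact ⟨fun _ => P, fun _ => by simp only; omega, by simp⟩
  | succ J ih =>
    rcases Nat.lt_or_ge P.natDegree (s - 1) with h | h
    · refine ⟨fun j => if j = 0 then P else 1, fun j => ?_, ?_⟩
      · dsimp only
        split_ifs
        · omega
        · simp
      · simp
    · rcases eq_or_ne P 0 with rfl | h0
      · exact ⟨fun _ => 0, fun _ => by simp, by simp⟩
      obtain ⟨g, ⟨r, rfl⟩, h1, h2⟩ := exists_dvd_natDegree_between P h0 (s - 1) h
      rw [natDegree_mul (left_ne_zero_of_mul h0) (right_ne_zero_of_mul h0)] at hP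
      obtain ⟨p, hp, hprod⟩ := ih r (by rw [Nat.succ_mul] at hP; omega)
      refine ⟨fun j => if j < J + 1 then p j else g, fun j => ?_, ?_⟩
      · dsimp only
        split_ifs
        · exact hp j
        · omega
      · rw [Finset.prod_range_succ, ← hprod, if_neg (lt_irrefl _), mul_comm]
        congr 1
        exact Finset.prod_congr rfl fun j hj => if_pos (Finset.mem_range.1 hj)

/-- A sequence supported in `{0, …, A}` is the convolution of `J` filters of length `s`, provided
that `A ≤ J (s - 1)`: its generating polynomial is a product of `J` polynomials of degree at most
`s`. -/
theorem exists_convProd_eq {s J A : ℕ} (hs : 2 ≤ s) (hJ : 0 < J) (hA : A ≤ J * (s - 1))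
    (W : ℕ → ℝ) (hW : ∀ i, A < i → W i = 0) :
    ∃ w : Fin J → Fin (s + 1) → ℝ, convProd w J le_rfl = W := by
  obtain ⟨J, rfl⟩ : ∃ J', J = J' + 1 := ⟨J - 1, by omega⟩
  set P : Polynomial ℝ := ∑ i ∈ Finset.range (A + 1), Polynomial.monomial i (W i) with hPdef
  have hcoeff : ∀ i, P.coeff i = W i := by
    intro i
    simp only [hPdef, Polynomial.finsetSum_coeff, Polynomial.coeff_monomial,
      Finset.sum_ite_eq', Finset.mem_range]
    split_ifs with h
    · rfl
    · exact (hW i (by omega)).symm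
  have hdeg : P.natDegree ≤ (J + 1) * (s - 1) := by
    refine (Polynomial.natDegree_le_iff_coeff_eq_zero.2 fun i hi => ?_).trans hA
    rw [hcoeff, hW i hi]
  obtain ⟨p, hp, hprod⟩ := exists_prod_natDegree_le hs J P hdeg
  refine ⟨fun j k => (p j).coeff k, ?_⟩
  have key : ∀ j (h : j ≤ J + 1),
      PowerSeries.mk (convProd (fun (j : Fin (J + 1)) (k : Fin (s + 1)) => (p j).coeff k) j h) =
        ((∏ i ∈ Finset.range j, p i : Polynomial ℝ) : PowerSeries ℝ) := by
    intro j
    induction j with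
    | zero =>
      intro h
      ext i
      simp [convProd, PowerSeries.coeff_one]
    | succ j ih =>
      intro h
      rw [convProd, mk_convSeq, ih, Finset.prod_range_succ, mul_comm, Polynomial.coe_mul]
      congr 1
      ext i
      simp only [PowerSeries.coeff_mk, filterSeq, Polynomial.coeff_coe]
      split_ifs with hi
      · rfl
      · exact (Polynomial.coeff_eq_zero_of_natDegree_lt (by have := hp j; omega)).symm
  ext i
  have := congrArg (PowerSeries.coeff i) (key (J + 1) le_rfl)
  rw [hprod] at this
  simpa [hcoeff] using this

/-! ### Layers acting affinely -/

/-- A vector of length `m` as a sequence, extended by zero. -/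
def zeroExt {m : ℕ} (v : Fin m → ℝ) (n : ℕ) : ℝ := if h : n < m then v ⟨n, h⟩ else 0

theorem convSeq_zeroExt {D : ℕ} (u : ℕ → ℝ) (v : Fin D → ℝ) (i : ℕ) :
    convSeq u (zeroExt v) i = ∑ k : Fin D, if (k : ℕ) ≤ i then u (i - k) * v k else 0 := by
  have h1 : (∑ k : Fin D, if (k : ℕ) ≤ i then u (i - k) * v k else 0) =
      ∑ k ∈ Finset.range D, if k ≤ i then u (i - k) * zeroExt v k else 0 := by
    rw [Finset.sum_range]
    refine Finset.sum_congr rfl fun k _ => ?_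
    simp [zeroExt]
  rw [h1, ← Finset.sum_filter, convSeq]
  symm
  refine Finset.sum_subset (fun k hk => ?_) fun k hk hk' => ?_
  · simp only [Finset.mem_filter, Finset.mem_range] at hk ⊢
    omega
  · simp only [Finset.mem_filter, Finset.mem_range, not_and] at hk hk'
    have : ¬ k < D := fun h => hk' h (by omega)
    simp [zeroExt, this]

theorem toeplitz_mulVec (D : ℕ) {s : ℕ} (w : Fin (s + 1) → ℝ) (v : Fin D → ℝ) (i : Fin (D + s)) :
    (toeplitz D w).mulVec v i = convSeq (filterSeq w) (zeroExt v) i := by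
  rw [convSeq_zeroExt, Matrix.mulVec, dotProduct]
  refine Finset.sum_congr rfl fun k _ => ?_
  simp only [toeplitz]
  split_ifs <;> simp

theorem filterSeq_eq_zero {s : ℕ} (w : Fin (s + 1) → ℝ) {n : ℕ} (hn : s < n) :
    filterSeq w n = 0 := by
  simp only [filterSeq]
  rw [dif_neg (by omega)]

theorem convProd_eq_zero {s J : ℕ} (w : Fin J → Fin (s + 1) → ℝ) (j : ℕ) (h : j ≤ J) (n : ℕ)
    (hn : j * s < n) : convProd w j h n = 0 := by
  induction j generalizing n with
  | zero => simp only [convProd]; rw [if_neg (by omega)]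
  | succ j ih =>
    rw [convProd, convSeq]
    refine Finset.sum_eq_zero fun k hk => ?_
    rw [Nat.succ_mul] at hn
    rcases Nat.lt_or_ge (j * s) k with h1 | h1
    · rw [ih _ _ h1, mul_zero]
    · rw [filterSeq_eq_zero _ (by omega), zero_mul]

/-- The linear part of the `j`-th layer has the width of that layer. -/
theorem convSeq_convProd_eq_zero {D s J : ℕ} (w : Fin J → Fin (s + 1) → ℝ) (j : ℕ) (h : j ≤ J)
    (y : Fin D → ℝ) (i : ℕ) (hi : convWidth D s j ≤ i) :
    convSeq (convProd w j h) (zeroExt y) i = 0 := by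
  rw [convSeq_zeroExt]
  refine Finset.sum_eq_zero fun k _ => ?_
  have := k.isLt
  rw [convWidth] at hi
  rw [convProd_eq_zero w j h _ (by omega), zero_mul, ite_self]

/-- The row sums of the convolutional matrix from width `D`, as a sequence. -/
def rowSum (D : ℕ) {s : ℕ} (w : Fin (s + 1) → ℝ) : ℕ → ℝ :=
  convSeq (filterSeq w) (zeroExt fun _ : Fin D => 1)

theorem rowSum_eq (D : ℕ) {s : ℕ} (w : Fin (s + 1) → ℝ) {i : ℕ} (h1 : s ≤ i) (h2 : i < D) :
    rowSum D w i = ∑ n ∈ Finset.range (s + 1), filterSeq w n := by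
  rw [rowSum, convSeq]
  have h3 : ∑ k ∈ Finset.range (i + 1), filterSeq w (i - k) * zeroExt (fun _ : Fin D => 1) k =
      ∑ k ∈ Finset.range (i + 1), filterSeq w (i + 1 - 1 - k) := by
    refine Finset.sum_congr rfl fun k hk => ?_
    have hk := Finset.mem_range.1 hk
    have : k < D := by omega
    simp [zeroExt, this]
  rw [h3, Finset.sum_range_reflect (filterSeq w)]
  symm
  refine Finset.sum_subset (fun k hk => ?_) fun k _ hk' => ?_
  · simp only [Finset.mem_range] at hk ⊢
    omega
  · simp only [Finset.mem_range] at hk'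
    exact filterSeq_eq_zero w (by omega)

/-- The biases that change a constant offset `a` into an offset `c` satisfy the restriction. -/
theorem biasRestricted_rowSum (D : ℕ) {s : ℕ} (w : Fin (s + 1) → ℝ) (a c : ℝ) :
    BiasRestricted D fun i : Fin (D + s) => a * rowSum D w i - c := by
  intro i i' h1 h2 h3 h4
  simp only [rowSum_eq D w h1 h2, rowSum_eq D w h3 h4]

/-- Every restricted bias is given by `2s + 1` numbers. For `D ≤ s` the common middle value does
not occur. -/
theorem exists_spreadBias_eq (D : ℕ) {s : ℕ} (b : Fin (D + s) → ℝ) (hb : BiasRestricted D b) :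
    ∃ p : Fin (2 * s + 1) → ℝ, spreadBias D p = b := by
  have hext : ∀ i : Fin (D + s), zeroExt b i = b i := fun i => by simp [zeroExt]
  refine ⟨fun k =>
    if (k : ℕ) < s then zeroExt b k
    else if (k : ℕ) = s then zeroExt b s
    else zeroExt b (k - (s + 1) + D), ?_⟩
  funext i
  rw [← hext i]
  by_cases h1 : (i : ℕ) < s
  · simp [spreadBias, h1]
  · by_cases h2 : (i : ℕ) < D
    · simp only [spreadBias, h1, h2, dif_neg, dif_pos, not_false_eq_true, lt_irrefl, if_false,
        if_true]
      rw [hext i, ← hb ⟨s, by omega⟩ i le_rfl (by simp only; omega) (by omega) h2, ← hext]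
    · have h3 : ¬ s + 1 + ((i : ℕ) - D) < s := by omega
      have h4 : ¬ s + 1 + ((i : ℕ) - D) = s := by omega
      have h5 : s + 1 + ((i : ℕ) - D) - (s + 1) + D = i := by omega
      simp only [spreadBias, h1, h2, dif_neg, not_false_eq_true, h3, h4, if_false, h5]

theorem toeplitz_mulVec_affine {D s J : ℕ} (w : Fin J → Fin (s + 1) → ℝ) (j : ℕ) (h : j + 1 ≤ J)
    (y : Fin D → ℝ) (c : ℝ) (i : Fin (convWidth D s j + s)) :
    (toeplitz (convWidth D s j) (w ⟨j, h⟩)).mulVec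
      (fun k => convSeq (convProd w j (Nat.le_of_succ_le h)) (zeroExt y) k + c) i =
      convSeq (convProd w (j + 1) h) (zeroExt y) i
        + c * rowSum (convWidth D s j) (w ⟨j, h⟩) i := by
  have h1 : (fun k : Fin (convWidth D s j) =>
      convSeq (convProd w j (Nat.le_of_succ_le h)) (zeroExt y) k + c) =
      (fun k : Fin (convWidth D s j) =>
        convSeq (convProd w j (Nat.le_of_succ_le h)) (zeroExt y) k) + c • (fun _ => (1 : ℝ)) := by
    funext k
    simp
  have h2 : zeroExt (fun k : Fin (convWidth D s j) =>
      convSeq (convProd w j (Nat.le_of_succ_le h)) (zeroExt y) k) =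
      convSeq (convProd w j (Nat.le_of_succ_le h)) (zeroExt y) := by
    funext n
    simp only [zeroExt]
    split_ifs with hn
    · rfl
    · exact (convSeq_convProd_eq_zero w j _ y n (not_lt.1 hn)).symm
  rw [h1, Matrix.mulVec_add, Matrix.mulVec_smul, Pi.add_apply, Pi.smul_apply, toeplitz_mulVec,
    toeplitz_mulVec, h2, ← convSeq_assoc]
  simp only [convProd, rowSum, smul_eq_mul]

/-- If the bias of layer `j` turns the offset `B j` of its input into the offset `B (j + 1)`, and
these offsets dominate the linear parts, then no rectifier is active and the layers of the stack
are affine. -/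
theorem convStack_affine {D s J : ℕ} (w : Fin J → Fin (s + 1) → ℝ)
    (b : (j : Fin J) → Fin (convWidth D s (j : ℕ) + s) → ℝ) (B : ℕ → ℝ) (y : Fin D → ℝ) (j : ℕ)
    (h : j ≤ J)
    (hb : ∀ j' : Fin J, (j' : ℕ) < j →
      ∀ i, b j' i = B j' * rowSum (convWidth D s j') (w j') i - B (j' + 1))
    (hB : ∀ j' (h' : j' ≤ J), 0 < j' → ∀ i, |convSeq (convProd w j' h') (zeroExt y) i| ≤ B j')
    (x : Fin D → ℝ) (hx : ∀ i, x i = y i + B 0) :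
    convStack w b x j h = fun i : Fin (convWidth D s j) =>
      convSeq (convProd w j h) (zeroExt y) i + B j := by
  induction j with
  | zero =>
    funext i
    have hi : (i : ℕ) < D := lt_of_lt_of_eq i.isLt (convWidth_zero D s).symm
    have h1 : ∀ k : Fin D, (if (k : ℕ) ≤ (i : ℕ) then (if (i : ℕ) - k = 0 then (1 : ℝ) else 0) * y k
        else 0) = if k = ⟨i, hi⟩ then y k else 0 := by
      intro k
      simp only [Fin.ext_iff]
      split_ifs <;> first | omega | simp
    simp only [convStack, hx, convSeq_zeroExt, convProd, h1, Finset.sum_ite_eq',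
      Finset.mem_univ, if_true]
    rfl
  | succ j ih =>
    have h1 := ih (Nat.le_of_succ_le h) (fun j' hj' => hb j' (by omega))
    funext i
    rw [convStack, h1]
    beta_reduce
    rw [toeplitz_mulVec_affine, hb ⟨j, h⟩ (Nat.lt_succ_self j)]
    have h2 := (abs_le.1 (hB (j + 1) h (Nat.succ_pos j) i)).1
    simp only [Fin.val_cast]
    rw [relu, max_eq_left (by linarith)]
    ring

/-- With an unrestricted bias in the last layer, that layer can apply the rectifier to the linear
part with any thresholds `τ`. -/
theorem convStack_last {D s J : ℕ} (hJ : 0 < J) (w : Fin J → Fin (s + 1) → ℝ)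
    (b : (j : Fin J) → Fin (convWidth D s (j : ℕ) + s) → ℝ) (B τ : ℕ → ℝ) (y : Fin D → ℝ)
    (hb : ∀ j : Fin J, (j : ℕ) + 1 < J →
      ∀ i, b j i = B j * rowSum (convWidth D s j) (w j) i - B (j + 1))
    (hb' : ∀ j : Fin J, (j : ℕ) + 1 = J →
      ∀ i, b j i = B j * rowSum (convWidth D s j) (w j) i + τ i)
    (hB : ∀ j (h : j ≤ J), 0 < j → ∀ i, |convSeq (convProd w j h) (zeroExt y) i| ≤ B j)
    (x : Fin D → ℝ) (hx : ∀ i, x i = y i + B 0) (i : Fin (convWidth D s J)) :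
    convStack w b x J le_rfl i = relu (convSeq (convProd w J le_rfl) (zeroExt y) i - τ i) := by
  obtain ⟨J, rfl⟩ : ∃ J', J = J' + 1 := ⟨J - 1, by omega⟩
  rw [convStack, convStack_affine w b B y J _ (fun j' hj' => hb j' (by omega)) hB x hx]
  beta_reduce
  rw [toeplitz_mulVec_affine, hb' ⟨J, _⟩ rfl]
  simp only [Fin.val_cast]
  congr 1
  ring

/-- Offsets that dominate the linear parts of all layers, uniformly on a cube of inputs. -/
theorem exists_convProd_bound {s J : ℕ} (w : Fin J → Fin (s + 1) → ℝ) (D : ℕ) (R c : ℝ)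
    (hR : 0 ≤ R) :
    ∃ B : ℕ → ℝ, B 0 = c ∧ ∀ j (h : j ≤ J), 0 < j → 0 ≤ B j ∧
      ∀ y : Fin D → ℝ, (∀ k, |y k| ≤ R) →
        ∀ i, |convSeq (convProd w j h) (zeroExt y) i| ≤ B j := by
  classical
  set M : (j : ℕ) → j ≤ J → ℝ := fun j h => ∑ n ∈ Finset.range (j * s + 1), |convProd w j h n|
    with hM
  have hM0 : ∀ j h, 0 ≤ M j h := fun j h => Finset.sum_nonneg fun _ _ => abs_nonneg _
  have hMn : ∀ j h n, |convProd w j h n| ≤ M j h := by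
    intro j h n
    rcases Nat.lt_or_ge (j * s) n with hn | hn
    · rw [convProd_eq_zero w j h n hn, abs_zero]
      exact hM0 j h
    · exact Finset.single_le_sum (f := fun n => |convProd w j h n|) (fun _ _ => abs_nonneg _)
        (Finset.mem_range.2 (by omega))
  refine ⟨fun j => if j = 0 then c else if h : j ≤ J then D * (M j h * R) else 0, if_pos rfl, ?_⟩
  intro j h hj
  simp only [hj.ne', if_false, dif_pos h]
  refine ⟨mul_nonneg (Nat.cast_nonneg _) (mul_nonneg (hM0 j h) hR), fun y hy i => ?_⟩
  rw [convSeq_zeroExt]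
  refine (Finset.abs_sum_le_sum_abs _ _).trans ?_
  refine (Finset.sum_le_card_nsmul _ _ (M j h * R) fun k _ => ?_).trans (by simp)
  split_ifs
  · rw [abs_mul]
    exact mul_le_mul (hMn _ _ _) (hy k) (abs_nonneg _) (hM0 j h)
  · rw [abs_zero]
    exact mul_nonneg (hM0 j h) hR

/-! ### Linear splines as combinations of shifted rectifiers -/

theorem abs_secondDiff_le {N : ℕ} {ζ : Fin (2 * N + 1) → ℝ} {M : ℝ} (hM : 0 ≤ M)
    (hζ : ∀ m, |ζ m| ≤ M) (i : Fin (2 * N + 3)) : |secondDiff N ζ i| ≤ 4 * M := by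
  have he : ∀ m : ℤ, |if h : 0 ≤ m ∧ m.toNat < 2 * N + 1 then ζ ⟨m.toNat, h.2⟩ else 0| ≤ M := by
    intro m
    split_ifs
    · exact hζ _
    · simpa using hM
  have h1 := abs_le.1 (he ((i : ℤ) - 2))
  have h2 := abs_le.1 (he ((i : ℤ) - 1))
  have h3 := abs_le.1 (he (i : ℤ))
  rw [secondDiff]
  exact abs_le.2 ⟨by linarith, by linarith⟩

/-- Summation by parts for the second difference. -/
theorem sum_secondDiff_mul (N : ℕ) (ζ : Fin (2 * N + 1) → ℝ) (r : ℕ → ℝ) :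
    ∑ i : Fin (2 * N + 3), secondDiff N ζ i * r i =
      ∑ m : Fin (2 * N + 1), ζ m * (r (m + 2) - 2 * r (m + 1) + r m) := by
  set e : ℤ → ℝ := fun m =>
    if h : 0 ≤ m ∧ m.toNat < 2 * N + 1 then ζ ⟨m.toNat, h.2⟩ else 0 with he
  have hneg : ∀ m : ℤ, m < 0 → e m = 0 := fun m hm => dif_neg (by omega)
  have hbig : ∀ m : ℤ, 2 * N + 1 ≤ m → e m = 0 := fun m hm => dif_neg (by omega)
  have hin : ∀ m : Fin (2 * N + 1), e ((m : ℕ) : ℤ) = ζ m := by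
    intro m
    have := m.isLt
    simp only [he]
    rw [dif_pos (by omega)]
    congr 1
  have hr : ∑ m : Fin (2 * N + 1), ζ m * (r (m + 2) - 2 * r (m + 1) + r m) =
      ∑ m ∈ Finset.range (2 * N + 1), e m * (r (m + 2) - 2 * r (m + 1) + r m) := by
    rw [Finset.sum_range]
    exact Finset.sum_congr rfl fun m _ => by rw [hin]
  have hl : ∑ i : Fin (2 * N + 3), secondDiff N ζ i * r i =
      ∑ i ∈ Finset.range (2 * N + 3), (e ((i : ℤ) - 2) - 2 * e ((i : ℤ) - 1) + e i) * r i := by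
    rw [Finset.sum_range]
    rfl
  have h0 : ∑ i ∈ Finset.range (2 * N + 3), e i * r i =
      ∑ m ∈ Finset.range (2 * N + 1), e m * r m := by
    rw [Finset.sum_range_succ, Finset.sum_range_succ, hbig _ (by push_cast; omega),
      hbig _ (by push_cast; omega)]
    ring
  have h1 : ∑ i ∈ Finset.range (2 * N + 3), e ((i : ℤ) - 1) * r i =
      ∑ m ∈ Finset.range (2 * N + 1), e m * r (m + 1) := by
    rw [Finset.sum_range_succ, Finset.sum_range_succ', hneg (((0 : ℕ) : ℤ) - 1) (by simp),
      hbig _ (by push_cast; omega)]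
    simp
  have h2 : ∑ i ∈ Finset.range (2 * N + 3), e ((i : ℤ) - 2) * r i =
      ∑ m ∈ Finset.range (2 * N + 1), e m * r (m + 2) := by
    rw [Finset.sum_range_succ', Finset.sum_range_succ', hneg (((0 : ℕ) : ℤ) - 2) (by simp),
      hneg (((0 + 1 : ℕ) : ℤ) - 2) (by simp)]
    simp only [zero_mul, add_zero]
    refine Finset.sum_congr rfl fun m _ => ?_
    congr 2
    push_cast
    ring
  rw [hl, hr]
  calc _ = (∑ i ∈ Finset.range (2 * N + 3), e ((i : ℤ) - 2) * r i)
        - 2 * (∑ i ∈ Finset.range (2 * N + 3), e ((i : ℤ) - 1) * r i)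
        + ∑ i ∈ Finset.range (2 * N + 3), e i * r i := by
          rw [Finset.mul_sum, ← Finset.sum_sub_distrib, ← Finset.sum_add_distrib]
          exact Finset.sum_congr rfl fun _ _ => by ring
    _ = _ := by
          rw [h0, h1, h2, Finset.mul_sum, ← Finset.sum_sub_distrib, ← Finset.sum_add_distrib]
          exact Finset.sum_congr rfl fun _ _ => by ring

/-- The hat function with support `[-1, 1]`. -/
def hat (t : ℝ) : ℝ := relu (t - 1) - 2 * relu t + relu (t + 1)

theorem hat_nonneg (t : ℝ) : 0 ≤ hat t := by
  simp only [hat, relu]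
  rcases max_cases (t - 1) 0 with h1 | h1 <;> rcases max_cases t 0 with h2 | h2 <;>
    rcases max_cases (t + 1) 0 with h3 | h3 <;> linarith

theorem hat_eq_zero {t : ℝ} (ht : 1 ≤ |t|) : hat t = 0 := by
  simp only [hat, relu]
  rcases le_abs.1 ht with h | h
  · rw [max_eq_left (by linarith), max_eq_left (by linarith), max_eq_left (by linarith)]
    ring
  · rw [max_eq_right (by linarith), max_eq_right (by linarith), max_eq_right (by linarith)]
    ring

/-- The shifted hat functions form a partition of unity; the sum telescopes. -/
theorem sum_hat (N : ℕ) {y : ℝ} (h0 : 0 ≤ y) (h1 : y ≤ 2 * N) :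
    ∑ m : Fin (2 * N + 1), hat (y - (m : ℕ)) = 1 := by
  have h2 : ∀ m : ℕ, hat (y - m) = (relu (y - m + 1) - relu (y - m))
      - (relu (y - (m + 1 : ℕ) + 1) - relu (y - (m + 1 : ℕ))) := by
    intro m
    have e1 : y - ((m + 1 : ℕ) : ℝ) + 1 = y - m := by push_cast; ring
    have e2 : y - ((m + 1 : ℕ) : ℝ) = y - m - 1 := by push_cast; ring
    rw [e1, e2, hat]
    ring
  rw [← Finset.sum_range fun m => hat (y - (m : ℕ)), Finset.sum_congr rfl fun m _ => h2 m,
    Finset.sum_range_sub' fun m : ℕ => relu (y - m + 1) - relu (y - m)]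
  simp only [relu]
  push_cast
  rw [max_eq_left (by linarith), max_eq_left (by linarith), max_eq_right (by linarith),
    max_eq_right (by linarith)]
  ring

/-- On `[-1, 1]` the combination of shifted rectifiers with coefficients `N L_N(ζ)` is the linear
spline with values `ζ` at the inner knots, so it is a convex combination of the values at knots
of distance at most `1 / N`. -/
theorem abs_spline_sub_le {N : ℕ} (hN : 1 ≤ N) (ζ : Fin (2 * N + 1) → ℝ) {u a δ : ℝ}
    (hu : |u| ≤ 1)
    (h : ∀ m : Fin (2 * N + 1), |u - (-1 + (m : ℝ) / N)| ≤ 1 / N → |ζ m - a| ≤ δ) :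
    |∑ i, N * secondDiff N ζ i * relu (u - knot N i) - a| ≤ δ := by
  have hN0 : (0 : ℝ) < N := by exact_mod_cast hN
  obtain ⟨hu1, hu2⟩ := abs_le.1 hu
  set y : ℝ := N * (u + 1) with hy
  have hscale : ∀ t : ℝ, (N : ℝ) * relu t = relu (N * t) := by
    intro t
    simp only [relu]
    rw [mul_max_of_nonneg _ _ hN0.le, mul_zero]
  have h1 : ∑ i, N * secondDiff N ζ i * relu (u - knot N i) =
      ∑ m : Fin (2 * N + 1), ζ m * hat (y - (m : ℕ)) := by
    have e1 : ∀ i : Fin (2 * N + 3), N * secondDiff N ζ i * relu (u - knot N i) =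
        secondDiff N ζ i * relu (y - ((i : ℕ) : ℝ) + 1) := by
      intro i
      rw [mul_comm (N : ℝ), mul_assoc, hscale, knot]
      congr 2
      rw [hy]
      field_simp
      ring
    rw [Finset.sum_congr rfl fun i _ => e1 i,
      sum_secondDiff_mul N ζ fun i : ℕ => relu (y - (i : ℝ) + 1)]
    refine Finset.sum_congr rfl fun m _ => ?_
    rw [hat]
    push_cast
    congr 4 <;> ring_nf
  have hsum := sum_hat N (y := y) (mul_nonneg hN0.le (by linarith)) (by
    rw [hy, mul_comm (2 : ℝ)]
    exact mul_le_mul_of_nonneg_left (by linarith) hN0.le)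
  have h2 : ∑ m : Fin (2 * N + 1), ζ m * hat (y - (m : ℕ)) - a =
      ∑ m : Fin (2 * N + 1), (ζ m - a) * hat (y - (m : ℕ)) := by
    simp only [sub_mul, Finset.sum_sub_distrib, ← Finset.mul_sum, hsum, mul_one]
  rw [h1, h2]
  calc |∑ m : Fin (2 * N + 1), (ζ m - a) * hat (y - (m : ℕ))|
      ≤ ∑ m : Fin (2 * N + 1), |(ζ m - a) * hat (y - (m : ℕ))| := Finset.abs_sum_le_sum_abs _ _
    _ ≤ ∑ m : Fin (2 * N + 1), δ * hat (y - (m : ℕ)) := by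
        refine Finset.sum_le_sum fun m _ => ?_
        rw [abs_mul, abs_of_nonneg (hat_nonneg _)]
        rcases le_or_gt 1 |y - (m : ℕ)| with hm | hm
        · simp [hat_eq_zero hm]
        · refine mul_le_mul_of_nonneg_right (h m ?_) (hat_nonneg _)
          have e2 : u - (-1 + (m : ℝ) / N) = (y - (m : ℕ)) / N := by
            rw [hy]
            field_simp
            ring
          rw [e2, abs_div, abs_of_pos hN0]
          gcongr
    _ = δ := by rw [← Finset.mul_sum, hsum, mul_one]

theorem abs_innerKnot_le {N : ℕ} (hN : 1 ≤ N) (m : Fin (2 * N + 1)) :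
    |-1 + (m : ℝ) / (N : ℝ)| ≤ 1 := by
  have hN0 : (0 : ℝ) < N := by exact_mod_cast hN
  have h1 : (m : ℝ) ≤ 2 * N := by
    have := m.isLt
    exact_mod_cast (by omega : (m : ℕ) ≤ 2 * N)
  have h2 : (m : ℝ) / N ≤ 2 := (div_le_iff₀ hN0).2 h1
  have h3 : 0 ≤ (m : ℝ) / N := by positivity
  exact abs_le.2 ⟨by linarith, by linarith⟩

theorem abs_spline_pow_sub_le {N : ℕ} (hN : 1 ≤ N) (ℓ : ℕ) {u : ℝ} (hu : |u| ≤ 1) :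
    |∑ i, N * powerDiff N ℓ i * relu (u - knot N i) - u ^ ℓ| ≤ ℓ / N := by
  refine abs_spline_sub_le hN _ hu fun m hm => ?_
  have hpow : ∀ a b : ℝ, |a| ≤ 1 → |b| ≤ 1 → |a ^ ℓ - b ^ ℓ| ≤ ℓ * |a - b| := by
    intro a b ha hb
    induction ℓ with
    | zero => simp
    | succ ℓ ih =>
      have e : a ^ (ℓ + 1) - b ^ (ℓ + 1) = a * (a ^ ℓ - b ^ ℓ) + (a - b) * b ^ ℓ := by ring
      rw [e]
      refine (abs_add_le _ _).trans ?_
      rw [abs_mul, abs_mul, abs_pow]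
      have h1 : |a| * |a ^ ℓ - b ^ ℓ| ≤ 1 * (ℓ * |a - b|) :=
        mul_le_mul ha ih (abs_nonneg _) zero_le_one
      have h2 : |a - b| * |b| ^ ℓ ≤ |a - b| * 1 :=
        mul_le_mul_of_nonneg_left (pow_le_one₀ (abs_nonneg _) hb) (abs_nonneg _)
      push_cast
      linarith
  refine (hpow _ _ (abs_innerKnot_le hN m) hu).trans ?_
  rw [abs_sub_comm, div_eq_mul_one_div (ℓ : ℝ)]
  exact mul_le_mul_of_nonneg_left hm (Nat.cast_nonneg _)

theorem abs_spline_pow_le {N : ℕ} (hN : 1 ≤ N) (ℓ : ℕ) {u : ℝ} (hu : |u| ≤ 1) :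
    |∑ i, N * powerDiff N ℓ i * relu (u - knot N i)| ≤ 1 := by
  have := abs_spline_sub_le (a := 0) (δ := 1) hN
    (fun m : Fin (2 * N + 1) => (-1 + (m : ℝ) / (N : ℝ)) ^ ℓ) hu fun m _ => ?_
  · simpa [powerDiff] using this
  rw [sub_zero, abs_pow]
  exact pow_le_one₀ (abs_nonneg _) (abs_innerKnot_le hN m)

/-! ### Representation of polynomials by powers of linear forms -/

theorem featureCount_mono {d q q' : ℕ} (h : q ≤ q') : featureCount d q ≤ featureCount d q' := by
  simp only [featureCount]
  rw [Nat.choose_symm_add (a := d - 1) (b := q) |>.symm,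
    Nat.choose_symm_add (a := d - 1) (b := q') |>.symm]
  exact Nat.choose_le_choose _ (by omega)

theorem support_subset_finsuppAntidiag {d q : ℕ} {p : MvPolynomial (Fin d) ℝ}
    (hp : p.IsHomogeneous q) : p.support ⊆ Finset.univ.finsuppAntidiag q := by
  intro a ha
  rw [Finset.mem_finsuppAntidiag]
  refine ⟨?_, Finset.subset_univ _⟩
  have h1 : a.degree = q := by
    by_contra h
    exact (MvPolynomial.mem_support_iff.1 ha) (hp.coeff_eq_zero h)
  rw [← h1, Finsupp.degree_eq_sum]

theorem isHomogeneous_eval_eq {d q : ℕ} {p : MvPolynomial (Fin d) ℝ} (hp : p.IsHomogeneous q)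
    (x : Fin d → ℝ) :
    MvPolynomial.eval x p =
      ∑ a ∈ Finset.univ.finsuppAntidiag q, p.coeff a * ∏ i, x i ^ a i := by
  rw [MvPolynomial.eval_eq']
  refine Finset.sum_subset (support_subset_finsuppAntidiag hp) fun a _ ha => ?_
  rw [MvPolynomial.notMem_support_iff.1 ha, zero_mul]

/-- There are `n_q` unit vectors that are unisolvent for the forms of degree `q`: the vectors of
all monomials of degree `q`, evaluated on the unit sphere, span a space of dimension at most `n_q`,
which is already spanned by `n_q` of them. -/
theorem exists_unisolvent (d q : ℕ) (hd : 0 < d) :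
    ∃ ξ : Fin (featureCount d q) → EuclideanSpace ℝ (Fin d), (∀ k, ‖ξ k‖ = 1) ∧
      ∀ p : MvPolynomial (Fin d) ℝ, p.IsHomogeneous q →
        (∀ k, MvPolynomial.eval (fun i => ξ k i) p = 0) → p = 0 := by
  set A : Finset (Fin d →₀ ℕ) := Finset.univ.finsuppAntidiag q with hA
  set ver : EuclideanSpace ℝ (Fin d) → (A → ℝ) := fun x a => ∏ i, x i ^ a.1 i with hver
  set S : Set (A → ℝ) := ver '' {x | ‖x‖ = 1} with hS
  obtain ⟨f, hfS, hspan, -⟩ := Submodule.exists_fun_fin_finrank_span_eq ℝ S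
  have hr : Module.finrank ℝ (Submodule.span ℝ S) ≤ featureCount d q := by
    refine (Submodule.finrank_le _).trans ?_
    rw [Module.finrank_fintype_fun_eq_card, Fintype.card_coe, hA,
      Finset.card_finsuppAntidiag_nat_eq_choose, Finset.card_univ, Fintype.card_fin, featureCount]
    rw [show d + q - 1 = d - 1 + q by omega]
  choose g hg hgf using hfS
  set e : EuclideanSpace ℝ (Fin d) := EuclideanSpace.single ⟨0, hd⟩ 1 with he
  have he1 : ‖e‖ = 1 := by simp [he]
  -- If the span is smaller, the remaining places are filled by an arbitrary unit vector.
  refine ⟨fun k => if h : (k : ℕ) < Module.finrank ℝ (Submodule.span ℝ S) then g ⟨k, h⟩ else e,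
    fun k => ?_, fun p hp hk => ?_⟩
  · dsimp only
    split_ifs
    · exact hg _
    · exact he1
  · set L : (A → ℝ) →ₗ[ℝ] ℝ := ∑ a : A, p.coeff a.1 • LinearMap.proj a with hL
    have hLver : ∀ x, L (ver x) = MvPolynomial.eval (fun i => x i) p := by
      intro x
      rw [isHomogeneous_eval_eq hp, ← hA, ← Finset.sum_coe_sort A, hL]
      simp [hver]
    have hker : Submodule.span ℝ S ≤ LinearMap.ker L := by
      rw [← hspan, Submodule.span_le]
      rintro _ ⟨j, rfl⟩
      have := hk ⟨j, lt_of_lt_of_le j.isLt hr⟩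
      simp only [j.isLt, dif_pos] at this
      rw [SetLike.mem_coe, LinearMap.mem_ker, ← hgf, hLver, this]
    have hunit : ∀ x : EuclideanSpace ℝ (Fin d), ‖x‖ = 1 →
        MvPolynomial.eval (fun i => x i) p = 0 := by
      intro x hx
      rw [← hLver]
      exact LinearMap.mem_ker.1 (hker (Submodule.subset_span ⟨x, hx, rfl⟩))
    -- By homogeneity, vanishing on the unit sphere is vanishing everywhere.
    have hscale : ∀ (c : ℝ) (x : EuclideanSpace ℝ (Fin d)), ‖x‖ = 1 →
        MvPolynomial.eval (fun i => c * x i) p = 0 := by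
      intro c x hx
      have h0 := hunit x hx
      rw [isHomogeneous_eval_eq hp] at h0 ⊢
      have : ∀ a ∈ (Finset.univ.finsuppAntidiag q : Finset (Fin d →₀ ℕ)),
          p.coeff a * ∏ i, (c * x i) ^ a i = c ^ q * (p.coeff a * ∏ i, x i ^ a i) := by
        intro a ha
        have ha := (Finset.mem_finsuppAntidiag.1 ha).1
        simp only [mul_pow, Finset.prod_mul_distrib, Finset.prod_pow_eq_pow_sum, ha]
        ring
      rw [Finset.sum_congr rfl this, ← Finset.mul_sum, h0, mul_zero]
    refine MvPolynomial.funext fun x => ?_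
    rw [map_zero]
    set y : EuclideanSpace ℝ (Fin d) := WithLp.toLp 2 x with hy
    rcases eq_or_ne y 0 with h0 | h0
    · have hx : x = fun i => 0 * e i := by
        funext i
        have : y i = 0 := by rw [h0]; rfl
        simpa [hy] using this
      rw [hx]
      exact hscale 0 e he1
    · have hny : ‖y‖ ≠ 0 := norm_ne_zero_iff.2 h0
      have hx : x = fun i => ‖y‖ * (‖y‖⁻¹ • y) i := by
        funext i
        simp [hy, ← mul_assoc]
        rw [← hy, mul_inv_cancel₀ hny, one_mul]
      rw [hx]
      refine hscale _ _ ?_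
      rw [norm_smul, norm_inv, norm_norm, inv_mul_cancel₀ hny]

/-- The linear form with coefficient vector `ξ`. -/
def linForm {d : ℕ} (ξ : Fin d → ℝ) : MvPolynomial (Fin d) ℝ := ∑ i, ξ i • MvPolynomial.X i

theorem linForm_pow_isHomogeneous {d : ℕ} (ξ : Fin d → ℝ) (ℓ : ℕ) :
    (linForm ξ ^ ℓ).IsHomogeneous ℓ := by
  have h : (linForm ξ).IsHomogeneous 1 := by
    refine MvPolynomial.IsHomogeneous.sum _ _ _ fun i _ => ?_
    rw [MvPolynomial.smul_eq_C_mul]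
    exact (MvPolynomial.isHomogeneous_X ℝ i).C_mul _
  simpa using h.pow ℓ

theorem isHomogeneous_eq_sum {d q : ℕ} {p : MvPolynomial (Fin d) ℝ} (hp : p.IsHomogeneous q) :
    p = ∑ a ∈ Finset.univ.finsuppAntidiag q, p.coeff a • MvPolynomial.monomial a 1 := by
  conv_lhs => rw [p.as_sum]
  simp only [MvPolynomial.smul_monomial, smul_eq_mul, mul_one]
  refine Finset.sum_subset (support_subset_finsuppAntidiag hp) fun a _ ha => ?_
  rw [MvPolynomial.notMem_support_iff.1 ha, map_zero]

/-- If the vectors `ξ_k` are unisolvent for the forms of degree `q`, then for `ℓ ≤ q` the powers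
`(ξ_k · x) ^ ℓ` span the forms of degree `ℓ`. A functional `L` on forms gives the polynomial
`η ↦ L ((η · x) ^ ℓ)`, whose coefficients are multinomial multiples of the values of `L` at
the monomials; if it vanishes at all `ξ_k`, so does its product with a monomial of degree `q - ℓ`,
and therefore it is zero. -/
theorem mem_span_linForm_pow {d q n : ℕ} (hd : 0 < d) (ξ : Fin n → Fin d → ℝ)
    (hξ : ∀ p : MvPolynomial (Fin d) ℝ, p.IsHomogeneous q →
      (∀ k, MvPolynomial.eval (ξ k) p = 0) → p = 0)
    {ℓ : ℕ} (hℓ : ℓ ≤ q) (P : MvPolynomial (Fin d) ℝ) (hP : P.IsHomogeneous ℓ) :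
    P ∈ Submodule.span ℝ (Set.range fun k => linForm (ξ k) ^ ℓ) := by
  by_contra hmem
  obtain ⟨L, hLP, hker⟩ := Submodule.exists_le_ker_of_notMem hmem
  set A : Finset (Fin d →₀ ℕ) := Finset.univ.finsuppAntidiag ℓ with hA
  have hAsum : ∀ a ∈ A, a.degree = ℓ := by
    intro a ha
    rw [Finsupp.degree_eq_sum]
    exact (Finset.mem_finsuppAntidiag.1 ha).1
  set pL : MvPolynomial (Fin d) ℝ :=
    ∑ a ∈ A, MvPolynomial.monomial a ((a.multinomial : ℝ) * L (MvPolynomial.monomial a 1)) with hpL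
  have hhom : pL.IsHomogeneous ℓ :=
    MvPolynomial.IsHomogeneous.sum _ _ _ fun a ha =>
      MvPolynomial.isHomogeneous_monomial _ (hAsum a ha)
  have heval : ∀ η : Fin d → ℝ, MvPolynomial.eval η pL = L (linForm η ^ ℓ) := by
    intro η
    rw [isHomogeneous_eq_sum (linForm_pow_isHomogeneous η ℓ), ← hA, hpL, map_sum, map_sum]
    refine Finset.sum_congr rfl fun a ha => ?_
    rw [map_smul, MvPolynomial.eval_monomial, linForm,
      MvPolynomial.coeff_linearCombination_X_pow_of_fintype,
      if_pos (show (a.sum fun _ m => m) = ℓ from hAsum a ha), smul_eq_mul]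
    ring
  have hzero : pL * MvPolynomial.X ⟨0, hd⟩ ^ (q - ℓ) = 0 := by
    refine hξ _ ?_ fun k => ?_
    · have h1 := hhom.mul ((MvPolynomial.isHomogeneous_X ℝ (⟨0, hd⟩ : Fin d)).pow (q - ℓ))
      rwa [one_mul, Nat.add_sub_cancel' hℓ] at h1
    · have h1 : L (linForm (ξ k) ^ ℓ) = 0 :=
        LinearMap.mem_ker.1 (hker (Submodule.subset_span ⟨k, rfl⟩))
      rw [map_mul, heval, h1, zero_mul]
  have hpL0 : pL = 0 := by
    rcases mul_eq_zero.1 hzero with h | h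
    · exact h
    · exact absurd h (pow_ne_zero _ (MvPolynomial.X_ne_zero _))
  apply hLP
  rw [isHomogeneous_eq_sum hP, map_sum]
  refine Finset.sum_eq_zero fun a ha => ?_
  have h1 : pL.coeff a = a.multinomial * L (MvPolynomial.monomial a 1) := by
    rw [hpL, MvPolynomial.coeff_sum, Finset.sum_eq_single a]
    · rw [MvPolynomial.coeff_monomial, if_pos rfl]
    · intro b _ hb
      rw [MvPolynomial.coeff_monomial, if_neg hb]
    · exact fun h => absurd ha h
  rw [hpL0, MvPolynomial.coeff_zero] at h1
  have h2 : (a.multinomial : ℝ) ≠ 0 := by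
    rw [Finsupp.multinomial_eq]
    exact_mod_cast (Nat.multinomial_pos _ _).ne'
  rw [map_smul, (mul_eq_zero.1 h1.symm).resolve_left h2, smul_zero]

theorem eval_linForm {d : ℕ} (ξ x : EuclideanSpace ℝ (Fin d)) :
    MvPolynomial.eval (fun i => x i) (linForm fun i => ξ i) = inner ℝ ξ x := by
  simp [linForm, PiLp.inner_apply, MvPolynomial.smul_eval, mul_comm]

theorem exists_ridge_representation {d : ℕ} (hd : 0 < d) (Q : MvPolynomial (Fin d) ℝ) :
    ∃ (ξ : Fin (featureCount d Q.totalDegree) → EuclideanSpace ℝ (Fin d))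
      (β : ℕ → Fin (featureCount d Q.totalDegree) → ℝ), (∀ k, ‖ξ k‖ = 1) ∧
      ∀ x : EuclideanSpace ℝ (Fin d), MvPolynomial.eval (fun i => x i) Q =
        MvPolynomial.eval (fun _ => 0) Q +
          ∑ ℓ ∈ Finset.range Q.totalDegree, ∑ k, β ℓ k * (inner ℝ (ξ k) x) ^ (ℓ + 1) := by
  obtain ⟨ξ, hξ1, hξ⟩ := exists_unisolvent d Q.totalDegree hd
  have h1 : ∀ ℓ, ∃ β : Fin (featureCount d Q.totalDegree) → ℝ, ℓ < Q.totalDegree →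
      ∑ k, β k • linForm (fun i => ξ k i) ^ (ℓ + 1) = Q.homogeneousComponent (ℓ + 1) := by
    intro ℓ
    by_cases hℓ : ℓ < Q.totalDegree
    · have := mem_span_linForm_pow hd (fun k i => ξ k i) hξ (ℓ := ℓ + 1) hℓ _
        (MvPolynomial.homogeneousComponent_isHomogeneous (ℓ + 1) Q)
      obtain ⟨β, hβ⟩ := (Submodule.mem_span_range_iff_exists_fun ℝ).1 this
      exact ⟨β, fun _ => hβ⟩
    · exact ⟨0, fun h => absurd h hℓ⟩
  choose β hβ using h1
  refine ⟨ξ, β, hξ1, fun x => ?_⟩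
  have h0 : MvPolynomial.eval (fun _ => 0) Q = Q.coeff 0 := by
    have := MvPolynomial.eval_zero' (σ := Fin d) (R := ℝ)
    rw [this, MvPolynomial.constantCoeff_eq]
  conv_lhs => rw [← MvPolynomial.sum_homogeneousComponent Q]
  rw [Finset.sum_range_succ', map_add, map_sum, MvPolynomial.homogeneousComponent_zero,
    MvPolynomial.eval_C, h0, add_comm]
  congr 1
  refine Finset.sum_congr rfl fun ℓ hℓ => ?_
  rw [← hβ ℓ (Finset.mem_range.1 hℓ), map_sum]
  refine Finset.sum_congr rfl fun k _ => ?_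
  rw [MvPolynomial.smul_eval, map_pow, eval_linForm]

/-! ### Depths, widths and the number of free parameters -/

theorem ceil_div_bounds {s : ℕ} (hs : 2 ≤ s) (a : ℕ) :
    a ≤ ⌈(a : ℚ) / ((s : ℚ) - 1)⌉₊ * (s - 1) ∧
      ⌈(a : ℚ) / ((s : ℚ) - 1)⌉₊ * (s - 1) < a + (s - 1) := by
  have h1 : ((s - 1 : ℕ) : ℚ) = (s : ℚ) - 1 := by
    rw [Nat.cast_sub (by omega)]
    simp
  have h2 : (0 : ℚ) < ((s - 1 : ℕ) : ℚ) := by exact_mod_cast (by omega : 0 < s - 1)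
  rw [← h1]
  constructor
  · have := (div_le_iff₀ h2).1 (Nat.le_ceil ((a : ℚ) / ((s - 1 : ℕ) : ℚ)))
    exact_mod_cast this
  · have h3 := Nat.ceil_lt_add_one (show 0 ≤ (a : ℚ) / ((s - 1 : ℕ) : ℚ) by positivity)
    have h4 := mul_lt_mul_of_pos_right h3 h2
    rw [add_mul, div_mul_cancel₀ _ h2.ne', one_mul] at h4
    exact_mod_cast h4

theorem featureCount_pos (d q : ℕ) : 0 < featureCount d q :=
  Nat.choose_pos (Nat.le_add_left q (d - 1))

theorem firstDepth_bounds {d s q : ℕ} (hs : 2 ≤ s) (hd : 0 < d) :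
    featureCount d q * d ≤ firstDepth d s q * (s - 1) + 1 ∧
      firstDepth d s q * (s - 1) + 1 < featureCount d q * d + (s - 1) := by
  have h1 : 1 ≤ featureCount d q * d := Nat.mul_pos (featureCount_pos d q) hd
  have h2 : (featureCount d q : ℚ) * d - 1 = ((featureCount d q * d - 1 : ℕ) : ℚ) := by
    rw [Nat.cast_sub h1]
    push_cast
    ring
  have h3 := ceil_div_bounds hs (featureCount d q * d - 1)
  rw [← h2] at h3
  change _ ≤ firstDepth d s q * (s - 1) ∧ firstDepth d s q * (s - 1) < _ at h3
  omega

theorem secondDepth_bounds {d s J₁ N : ℕ} (hs : 2 ≤ s) :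
    (2 * N + 3) * midWidth d s J₁ ≤ secondDepth d s J₁ N * (s - 1) ∧
      secondDepth d s J₁ N * (s - 1) < (2 * N + 3) * midWidth d s J₁ + (s - 1) := by
  have h3 := ceil_div_bounds hs ((2 * N + 3) * midWidth d s J₁)
  push_cast at h3
  exact h3

theorem featureCount_le_midWidth {d s q : ℕ} (hs : 2 ≤ s) (hd : 0 < d) :
    featureCount d q ≤ midWidth d s (firstDepth d s q) := by
  rw [midWidth, Nat.le_div_iff_mul_le hd, convWidth]
  have h1 := (firstDepth_bounds (q := q) hs hd).1
  have h2 : firstDepth d s q * (s - 1) ≤ firstDepth d s q * s := Nat.mul_le_mul_left _ (by omega)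
  omega

theorem firstDepth_pos {d s q : ℕ} (hs : 2 ≤ s) (hd : 2 ≤ d) : 0 < firstDepth d s q := by
  by_contra h
  have h0 : firstDepth d s q = 0 := by omega
  have h1 := (firstDepth_bounds (q := q) hs (by omega : 0 < d)).1
  rw [h0] at h1
  have h2 : 1 * 2 ≤ featureCount d q * d := Nat.mul_le_mul (featureCount_pos d q) hd
  omega

theorem secondDepth_pos {d s q N : ℕ} (hs : 2 ≤ s) (hd : 0 < d) :
    0 < secondDepth d s (firstDepth d s q) N := by
  by_contra h
  have h0 : secondDepth d s (firstDepth d s q) N = 0 := by omega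
  have h1 := (secondDepth_bounds (d := d) (J₁ := firstDepth d s q) (N := N) hs).1
  rw [h0] at h1
  have h2 : 0 < midWidth d s (firstDepth d s q) :=
    lt_of_lt_of_le (featureCount_pos d q) (featureCount_le_midWidth hs hd)
  have h3 : 0 < (2 * N + 3) * midWidth d s (firstDepth d s q) := Nat.mul_pos (by omega) h2
  omega

theorem firstDepth_lt {d s q : ℕ} (hs : 2 ≤ s) (hd : 0 < d) :
    firstDepth d s q < featureCount d q * d := by
  have h1 := (firstDepth_bounds (q := q) hs hd).2
  have h2 : 0 < featureCount d q * d := Nat.mul_pos (featureCount_pos d q) hd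
  generalize firstDepth d s q = J at *
  generalize featureCount d q * d = m at *
  obtain ⟨t, rfl⟩ : ∃ t, s = t + 2 := ⟨s - 2, by omega⟩
  rw [show t + 2 - 1 = t + 1 by omega, Nat.mul_succ] at h1
  by_contra h
  have h3 : 1 * t ≤ J * t := Nat.mul_le_mul_right _ (by omega)
  omega

/-- The bound `⌊(d + J₁ s) / d⌋ ≤ 2 n_q + 1`, where `s ≤ d` enters. -/
theorem midWidth_le {d s q : ℕ} (hs : 2 ≤ s) (hsd : s ≤ d) :
    midWidth d s (firstDepth d s q) ≤ 2 * featureCount d q + 1 := by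
  have h1 := (firstDepth_bounds (q := q) hs (by omega : 0 < d)).2
  have h3 : firstDepth d s q * s = firstDepth d s q * (s - 1) + firstDepth d s q := by
    rw [← Nat.mul_succ]
    congr 1
    omega
  have h4 := firstDepth_lt (q := q) hs (by omega : 0 < d)
  have h7 : (2 * featureCount d q + 2) * d = 2 * (featureCount d q * d) + 2 * d := by ring
  rw [midWidth, convWidth]
  refine Nat.le_of_lt_succ ((Nat.div_lt_iff_lt_mul (by omega)).2 ?_)
  change d + firstDepth d s q * s < (2 * featureCount d q + 2) * d
  omega

/-- The free parameters as a disjoint union of index sets. -/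
def freeIndexEquiv (d s q N : ℕ) : FreeIndex d s q N ≃
    ((Fin (firstDepth d s q) × Fin (s + 1)) ⊕ (Fin (firstDepth d s q) × Fin (2 * s + 1))) ⊕
    ((Fin (secondDepth d s (firstDepth d s q) N - 1) × Fin (2 * s + 1)) ⊕
      Fin (topWidth d s (firstDepth d s q) N)) ⊕
    ((Fin q × Fin (featureCount d q)) ⊕ (Fin 2 ⊕ Fin (2 * N + 1))) where
  toFun
    | .filter j k => .inl (.inl (j, k))
    | .bias₁ j k => .inl (.inr (j, k))
    | .bias₂ j k => .inr (.inl (.inl (j, k)))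
    | .topBias i => .inr (.inl (.inr i))
    | .ridge ℓ k => .inr (.inr (.inl (ℓ, k)))
    | .const => .inr (.inr (.inr (.inl 0)))
    | .scale => .inr (.inr (.inr (.inl 1)))
    | .sample m => .inr (.inr (.inr (.inr m)))
  invFun
    | .inl (.inl (j, k)) => .filter j k
    | .inl (.inr (j, k)) => .bias₁ j k
    | .inr (.inl (.inl (j, k))) => .bias₂ j k
    | .inr (.inl (.inr i)) => .topBias i
    | .inr (.inr (.inl (ℓ, k))) => .ridge ℓ k
    | .inr (.inr (.inr (.inl 0))) => .const
    | .inr (.inr (.inr (.inl 1))) => .scale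
    | .inr (.inr (.inr (.inr m))) => .sample m
  left_inv x := by cases x <;> rfl
  right_inv x := by
    rcases x with (⟨j, k⟩ | ⟨j, k⟩) | ((⟨j, k⟩ | i) | (⟨ℓ, k⟩ | (i | m)))
    any_goals rfl
    fin_cases i <;> rfl

theorem freeCount_eq (d s q N : ℕ) :
    freeCount d s q N =
      firstDepth d s q * (s + 1) + firstDepth d s q * (2 * s + 1) +
      ((secondDepth d s (firstDepth d s q) N - 1) * (2 * s + 1) +
        topWidth d s (firstDepth d s q) N + (q * featureCount d q + (2 + (2 * N + 1)))) := by
  rw [freeCount, Nat.card_congr (freeIndexEquiv d s q N), Nat.card_eq_fintype_card]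
  simp only [Fintype.card_sum, Fintype.card_prod, Fintype.card_fin]

theorem freeCount_le {d s q N : ℕ} (hs : 2 ≤ s) (hsd : s ≤ d) :
    freeCount d s q N ≤ (30 + 28 * featureCount d q) * N
      + (8 * d + q + 44) * featureCount d q + 4 * s + 49 := by
  have hd : 0 < d := by omega
  obtain ⟨hJ1, hJ2⟩ := firstDepth_bounds (q := q) hs hd
  obtain ⟨hM1, hM2⟩ := secondDepth_bounds (d := d) (J₁ := firstDepth d s q) (N := N) hs
  have hMpos := secondDepth_pos (q := q) (N := N) hs hd
  have hD := midWidth_le (q := q) hs hsd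
  have hJn := firstDepth_lt (q := q) hs hd
  rw [freeCount_eq, topWidth, convWidth]
  generalize secondDepth d s (firstDepth d s q) N = M at *
  generalize midWidth d s (firstDepth d s q) = D at *
  generalize firstDepth d s q = J at *
  generalize featureCount d q = n at *
  obtain ⟨t, rfl⟩ : ∃ t, s = t + 2 := ⟨s - 2, by omega⟩
  obtain ⟨M, rfl⟩ : ∃ M', M = M' + 1 := ⟨M - 1, by omega⟩
  have hA : (2 * N + 3) * D ≤ (2 * N + 3) * (2 * n + 1) := Nat.mul_le_mul_left _ hD
  generalize (2 * N + 3) * D = A at *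
  simp only [Nat.add_sub_cancel, show t + 2 - 1 = t + 1 by omega] at *
  have h1 : J * (t + 1) = J * t + J := by ring
  have h2 : (M + 1) * (t + 1) = M * t + M + t + 1 := by ring
  have h3 : J * (t + 2 + 1) + J * (2 * (t + 2) + 1) + (M * (2 * (t + 2) + 1) +
      (D + (M + 1) * (t + 2)) + (q * n + (2 + (2 * N + 1)))) =
      3 * (J * t) + 8 * J + (3 * (M * t) + 7 * M + D + t + 2 + q * n + 3 + 2 * N) := by ring
  have h4 : (2 * N + 3) * (2 * n + 1) = 4 * (n * N) + 2 * N + 6 * n + 3 := by ring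
  have h5 : (30 + 28 * n) * N + (8 * d + q + 44) * n + 4 * (t + 2) + 49 =
      30 * N + 28 * (n * N) + 8 * (n * d) + q * n + 44 * n + 4 * t + 57 := by ring
  rw [h3, h5]
  rw [h1] at hJ1 hJ2
  rw [h2] at hM1 hM2
  rw [h4] at hA
  omega

/-- Monomials of degree `q` are words of length `q` up to permutation. -/
theorem featureCount_le_pow {d q : ℕ} (hd : 0 < d) : featureCount d q ≤ d ^ q := by
  have h1 : featureCount d q = Fintype.card (Sym (Fin d) q) := by
    rw [Sym.card_sym_eq_choose, Fintype.card_fin, featureCount]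
    congr 1
    omega
  have h2 : Fintype.card (List.Vector (Fin d) q) = d ^ q := by
    rw [card_vector, Fintype.card_fin]
  rw [h1, ← h2]
  refine Fintype.card_le_of_surjective Sym.ofVector fun m => ?_
  obtain ⟨m, hm⟩ := m
  induction m using Quotient.inductionOn with
  | h l => exact ⟨⟨l, hm⟩, rfl⟩

/-! ### The network evaluated -/

/-- The filter whose convolutional matrix has the vectors `ξ_k`, placed in reverse order one after
the other, in the rows kept by the downsampling operator. -/
def ridgeSeq {d n : ℕ} (ξ : Fin n → Fin d → ℝ) (i : ℕ) : ℝ :=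
  if h : i / d < n ∧ 0 < d then ξ ⟨i / d, h.1⟩ ⟨d - 1 - i % d, by omega⟩ else 0

theorem convSeq_ridgeSeq {d n : ℕ} (ξ : Fin n → Fin d → ℝ) (hd : 0 < d) (x : Fin d → ℝ)
    (k : Fin n) : convSeq (ridgeSeq ξ) (zeroExt x) (((k : ℕ) + 1) * d - 1) = ∑ i, ξ k i * x i := by
  rw [convSeq_zeroExt]
  refine Finset.sum_congr rfl fun i _ => ?_
  have hi := i.isLt
  have h0 : ((k : ℕ) + 1) * d = k * d + d := by ring
  have h1 : (((k : ℕ) + 1) * d - 1 - i) = (d - 1 - i) + d * k := by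
    rw [h0, mul_comm d]
    omega
  have h2 : ((d - 1 - i) + d * k) / d = k := by
    rw [Nat.add_mul_div_left _ _ hd, Nat.div_eq_of_lt (by omega), zero_add]
  have h3 : ((d - 1 - i) + d * k) % d = d - 1 - i := by
    rw [Nat.add_mul_mod_self_left, Nat.mod_eq_of_lt (by omega)]
  rw [if_pos (by rw [h0]; omega), h1]
  congr 1
  rw [ridgeSeq, dif_pos ⟨by rw [h2]; exact k.isLt, hd⟩]
  congr 1
  · exact Fin.ext h2
  · ext
    simp only [h3]
    omega

theorem ridgeSeq_eq_zero {d n : ℕ} (ξ : Fin n → Fin d → ℝ) {i : ℕ} (hi : n * d - 1 < i) :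
    ridgeSeq ξ i = 0 := by
  rw [ridgeSeq, dif_neg]
  rintro ⟨h1, h2⟩
  have := (Nat.div_lt_iff_lt_mul h2).1 h1
  omega

/-- Convolution with the spike sequence repeats a vector of length `D` periodically. -/
theorem convSeq_spikeSeq {D N : ℕ} (y : Fin D → ℝ) {j : ℕ} (hj : j ≤ 2 * N + 3) (k : Fin D) :
    convSeq (spikeSeq D N) (zeroExt y) (j * D + k) = y k := by
  rw [convSeq_zeroExt, Finset.sum_eq_single k]
  · have h1 : j * D ≤ (2 * N + 3) * D := Nat.mul_le_mul_right _ hj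
    rw [if_pos (by omega), Nat.add_sub_cancel, spikeSeq,
      if_pos ⟨Dvd.intro_left j rfl, h1⟩, one_mul]
  · intro i _ hik
    split_ifs with h
    · rw [spikeSeq, if_neg, zero_mul]
      rintro ⟨⟨c, hc⟩, -⟩
      have hi := i.isLt
      have hk := k.isLt
      have h2 : j * D + k = i + D * c := by omega
      have h3 := congrArg (· % D) h2
      simp only [Nat.add_mul_mod_self_left, Nat.mul_add_mod_self_right, Nat.mod_eq_of_lt hi,
        Nat.mod_eq_of_lt hk] at h3
      exact hik (Fin.ext h3.symm)
    · rfl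
  · exact fun h => absurd (Finset.mem_univ k) h

theorem exists_spikeFactorization {d s q : ℕ} (N : ℕ) (hs : 2 ≤ s) (hd : 0 < d) :
    ∃ w : Fin (secondDepth d s (firstDepth d s q) N) → Fin (s + 1) → ℝ,
      IsSpikeFactorization w :=
  exists_convProd_eq hs (secondDepth_pos hs hd) (secondDepth_bounds hs).1 _
    fun i hi => if_neg fun h => by omega

theorem splineMatrix_mulVec {N q n D m : ℕ} (hn : n ≤ D) (hm : (2 * N + 3) * D ≤ m) (H : ℕ → ℝ)
    (r : Fin q × Fin n) :
    (splineMatrix N q n D m).mulVec (fun c => H c) r =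
      ∑ j : Fin (2 * N + 3), N * powerDiff N (r.1 + 1) j * H (j * D + r.2) := by
  have hr := r.2.isLt
  have hlt : ∀ j : Fin (2 * N + 3), (j : ℕ) * D + r.2 < m := by
    intro j
    have h1 : ((j : ℕ) + 1) * D ≤ (2 * N + 3) * D := Nat.mul_le_mul_right _ j.isLt
    rw [Nat.succ_mul] at h1
    omega
  have hdiv : ∀ j : ℕ, (j * D + r.2) / D = j := by
    intro j
    rw [mul_comm, Nat.mul_add_div (by omega), Nat.div_eq_of_lt (by omega), add_zero]
  have hmod : ∀ j : ℕ, (j * D + r.2) % D = r.2 := by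
    intro j
    rw [Nat.mul_add_mod_self_right, Nat.mod_eq_of_lt (by omega)]
  symm
  rw [Matrix.mulVec, dotProduct]
  refine Finset.sum_of_injOn (fun j => (⟨j * D + r.2, hlt j⟩ : Fin m)) ?_ ?_ ?_ ?_
  · intro j _ j' _ h
    have h1 := congrArg (· / D) (Fin.ext_iff.1 h)
    simp only [hdiv] at h1
    exact Fin.ext h1
  · exact fun _ _ => Finset.mem_coe.2 (Finset.mem_univ _)
  · intro c _ hc
    rw [splineMatrix, dif_neg, zero_mul]
    rintro ⟨h1, h2⟩
    refine hc ⟨⟨(c : ℕ) / D, h1⟩, Finset.mem_coe.2 (Finset.mem_univ _), Fin.ext ?_⟩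
    simp only
    rw [← h2, mul_comm, Nat.div_add_mod]
  · intro j _
    simp only [splineMatrix]
    rw [dif_pos ⟨by rw [hdiv]; exact j.isLt, hmod j⟩]
    congr 3
    exact Fin.ext (hdiv j).symm

/-- For any values of the parameters in the fully connected layer, the filters and biases of the
convolutional layers can be chosen such that the fully connected layer receives the shifted
rectifiers `σ(ξ_k · x - t_j)`. -/
theorem exists_parameters {d s q N : ℕ} (hs : 2 ≤ s) (hsd : s ≤ d)
    (w₂ : Fin (secondDepth d s (firstDepth d s q) N) → Fin (s + 1) → ℝ)
    (hw₂ : IsSpikeFactorization w₂)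
    (ξ : Fin (featureCount d q) → EuclideanSpace ℝ (Fin d))
    (β : Fin q → Fin (featureCount d q) → ℝ) (Q₀ Bhat : ℝ) (ζ : Fin (2 * N + 1) → ℝ) :
    ∃ θ : FreeIndex d s q N → ℝ, θ .scale = Bhat ∧ θ .const = Q₀ ∧
      (∀ ℓ k, θ (.ridge ℓ k) = β ℓ k) ∧ (∀ m, θ (.sample m) = ζ m) ∧
      ∀ x : EuclideanSpace ℝ (Fin d), ‖x‖ ≤ 1 → ∀ i,
        (buildNet w₂ θ).lastLayer (fun i => x i) i =
          relu (Q₀ + (∑ k, ∑ ℓ : Fin q, β ℓ k * ∑ j, N * powerDiff N (ℓ + 1) j *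
            relu (inner ℝ (ξ k) x - knot N j)) - Bhat * knot N i) := by
  have hd : 0 < d := by omega
  have hJpos : 0 < firstDepth d s q := firstDepth_pos hs (by omega)
  have hMpos : 0 < secondDepth d s (firstDepth d s q) N := secondDepth_pos hs hd
  have hnD : featureCount d q ≤ midWidth d s (firstDepth d s q) := featureCount_le_midWidth hs hd
  have htop : (2 * N + 3) * midWidth d s (firstDepth d s q) ≤
      topWidth d s (firstDepth d s q) N := by
    have h1 := (secondDepth_bounds (d := d) (J₁ := firstDepth d s q) (N := N) hs).1
    have h2 : secondDepth d s (firstDepth d s q) N * (s - 1) ≤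
      secondDepth d s (firstDepth d s q) N * s := Nat.mul_le_mul_left _ (by omega)
    rw [topWidth, convWidth]
    omega
  obtain ⟨w₁, hw₁⟩ : ∃ w₁ : Fin (firstDepth d s q) → Fin (s + 1) → ℝ,
      convProd w₁ (firstDepth d s q) le_rfl = ridgeSeq fun k i => ξ k i :=
    exists_convProd_eq hs hJpos
      (by have := (firstDepth_bounds (q := q) hs hd).1; omega) _ fun i hi => ridgeSeq_eq_zero _ hi
  -- `B₁ j` and `B₂ j` are the constants added to the linear parts of the layers of the two groups;
  -- the second group starts from the offset at which the first one ends.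
  obtain ⟨B₁, hB₁0, hB₁⟩ := exists_convProd_bound w₁ d 1 0 zero_le_one
  have hR : 0 ≤ B₁ (firstDepth d s q) := (hB₁ _ le_rfl hJpos).1
  obtain ⟨B₂, hB₂0, hB₂⟩ := exists_convProd_bound w₂ (midWidth d s (firstDepth d s q))
    (B₁ (firstDepth d s q)) (B₁ (firstDepth d s q)) hR
  choose p₁ hp₁ using fun j : Fin (firstDepth d s q) =>
    exists_spreadBias_eq _ _ (biasRestricted_rowSum (convWidth d s j) (w₁ j) (B₁ j) (B₁ (j + 1)))
  choose p₂ hp₂ using fun j : Fin (secondDepth d s (firstDepth d s q) N) =>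
    exists_spreadBias_eq _ _ (biasRestricted_rowSum
      (convWidth (midWidth d s (firstDepth d s q)) s j) (w₂ j) (B₂ j) (B₂ (j + 1)))
  -- The threshold of the `j`-th copy of the intermediate layer is the knot `t_j`.
  set τ : ℕ → ℝ := fun i =>
    -1 + (((i / midWidth d s (firstDepth d s q) : ℕ) : ℝ) - 1) / (N : ℝ) with hτ
  set θ : FreeIndex d s q N → ℝ := fun
    | .filter j k => w₁ j k
    | .bias₁ j k => p₁ j k
    | .bias₂ j k => p₂ ⟨j, by omega⟩ k
    | .topBias i => B₂ (secondDepth d s (firstDepth d s q) N - 1) *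
        rowSum (convWidth (midWidth d s (firstDepth d s q)) s
          (secondDepth d s (firstDepth d s q) N - 1))
          (w₂ ⟨secondDepth d s (firstDepth d s q) N - 1, by omega⟩) i + τ i
    | .ridge ℓ k => β ℓ k
    | .const => Q₀
    | .scale => Bhat
    | .sample m => ζ m with hθ
  refine ⟨θ, rfl, rfl, fun _ _ => rfl, fun _ => rfl, fun x hx i => ?_⟩
  have hx1 : ∀ i, |x i| ≤ 1 := fun i => (PiLp.norm_apply_le x i).trans hx
  set lin : ℕ → ℝ := convSeq (ridgeSeq fun k i => ξ k i) (zeroExt fun i => x i) with hlin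
  set y : Fin (midWidth d s (firstDepth d s q)) → ℝ := fun k => lin (((k : ℕ) + 1) * d - 1) with hy
  have hmid : (buildNet w₂ θ).midLayer (fun i => x i) =
      fun k => y k + B₁ (firstDepth d s q) := by
    have h1 := convStack_affine w₁ (buildNet w₂ θ).b₁ B₁ (fun i => x i) (firstDepth d s q) le_rfl
      (fun j _ i => congrFun (hp₁ j) i)
      (fun j h hj i => (hB₁ j h hj).2 _ hx1 i) (fun i => x i)
      (fun i => by rw [hB₁0, add_zero])
    funext k
    simp only [DCNN.midLayer, downsample]
    have h2 : (buildNet w₂ θ).w₁ = w₁ := rfl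
    rw [h2, h1, hw₁]
  have hyB : ∀ k, |y k| ≤ B₁ (firstDepth d s q) := by
    intro k
    have := (hB₁ _ le_rfl hJpos).2 _ hx1 (((k : ℕ) + 1) * d - 1)
    rwa [hw₁] at this
  set H : ℕ → ℝ := fun c =>
    relu (convSeq (spikeSeq (midWidth d s (firstDepth d s q)) N) (zeroExt y) c - τ c) with hH
  have htopLayer : (buildNet w₂ θ).topLayer (fun i => x i) =
      fun c : Fin (topWidth d s (firstDepth d s q) N) => H c := by
    funext c
    have h1 := convStack_last hMpos w₂ (buildNet w₂ θ).b₂ B₂ τ y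
      (fun j hj i => by
        simp only [buildNet, hj, dif_pos]
        exact congrFun (hp₂ j) i)
      (fun j hj i => by
        have hj' : ¬ (j : ℕ) + 1 < secondDepth d s (firstDepth d s q) N := by omega
        simp only [buildNet, hj', dif_neg, not_false_eq_true, hθ]
        have h1 : ∀ j₀ : Fin (secondDepth d s (firstDepth d s q) N), j₀ = j →
            B₂ j₀ * rowSum (convWidth (midWidth d s (firstDepth d s q)) s j₀) (w₂ j₀) i + τ i =
            B₂ j * rowSum (convWidth (midWidth d s (firstDepth d s q)) s j) (w₂ j) i + τ i := by
          rintro _ rfl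
          rfl
        exact h1 ⟨secondDepth d s (firstDepth d s q) N - 1, by omega⟩
          (Fin.ext (by simp only; omega)))
      (fun j h hj i => (hB₂ j h hj).2 _ hyB i)
      ((buildNet w₂ θ).midLayer fun i => x i) (fun k => by rw [hmid, hB₂0]) c
    rw [hw₂] at h1
    exact h1
  have hF : (buildNet w₂ θ).F.mulVec ((buildNet w₂ θ).topLayer fun i => x i) i =
      ∑ k, ∑ ℓ : Fin q, β ℓ k * ∑ j, N * powerDiff N (ℓ + 1) j *
            relu (inner ℝ (ξ k) x - knot N j) := by
    have h1 : (buildNet w₂ θ).F.mulVec ((buildNet w₂ θ).topLayer fun i => x i) i =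
        (fun r : Fin q × Fin (featureCount d q) => β r.1 r.2) ⬝ᵥ
          (splineMatrix N q (featureCount d q) (midWidth d s (firstDepth d s q))
            (topWidth d s (firstDepth d s q) N)).mulVec
            ((buildNet w₂ θ).topLayer fun i => x i) := by
      rw [Matrix.dotProduct_mulVec]
      rfl
    rw [h1, htopLayer, dotProduct, Fintype.sum_prod_type, Finset.sum_comm]
    refine Finset.sum_congr rfl fun k _ => Finset.sum_congr rfl fun ℓ _ => ?_
    rw [splineMatrix_mulVec hnD htop]
    congr 1
    refine Finset.sum_congr rfl fun j _ => ?_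
    have hkD : (k : ℕ) < midWidth d s (firstDepth d s q) := lt_of_lt_of_le k.isLt hnD
    have h2 := convSeq_spikeSeq (N := N) y (j := (j : ℕ)) (by omega) ⟨k, hkD⟩
    have h3 : y ⟨k, hkD⟩ = inner ℝ (ξ k) x := by
      simp only [hy, hlin]
      rw [convSeq_ridgeSeq _ hd, PiLp.inner_apply]
      exact Finset.sum_congr rfl fun i _ => by simp [mul_comm]
    have h4 : τ ((j : ℕ) * midWidth d s (firstDepth d s q) + k) = knot N j := by
      simp only [hτ, knot]
      rw [mul_comm (j : ℕ), Nat.mul_add_div (by omega), Nat.div_eq_of_lt hkD, add_zero]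
    simp only at h2
    simp only [hH, h2, h3, h4]
  rw [DCNN.lastLayer, hF]
  simp only [buildNet, hθ]
  congr 1
  ring

/-! ### Hölder functions on the range of the polynomial -/

theorem polySup_nonneg {d : ℕ} (Q : MvPolynomial (Fin d) ℝ)
    (Ω : Set (EuclideanSpace ℝ (Fin d))) : 0 ≤ polySup Q Ω := by
  refine Real.sSup_nonneg ?_
  rintro _ ⟨x, -, rfl⟩
  exact abs_nonneg _

theorem abs_eval_le_polySup {d : ℕ} (Q : MvPolynomial (Fin d) ℝ)
    {Ω : Set (EuclideanSpace ℝ (Fin d))} (hΩ : Ω ⊆ Metric.closedBall 0 1)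
    {x : EuclideanSpace ℝ (Fin d)} (hx : x ∈ Ω) :
    |MvPolynomial.eval (fun i => x i) Q| ≤ polySup Q Ω := by
  refine le_csSup ?_ ⟨x, hx, rfl⟩
  have hcont : Continuous fun x : EuclideanSpace ℝ (Fin d) =>
      |MvPolynomial.eval (fun i => x i) Q| :=
    ((MvPolynomial.continuous_eval Q).comp (by fun_prop)).abs
  exact ((isCompact_closedBall _ _).image hcont).bddAbove.mono (Set.image_mono hΩ)

theorem holderSeminorm_nonneg (f : ℝ → ℝ) (B α : ℝ) : 0 ≤ holderSeminorm f B α := by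
  refine Real.sSup_nonneg ?_
  rintro _ ⟨u, -, v, -, -, rfl⟩
  positivity

theorem MemHolder.abs_sub_le {f : ℝ → ℝ} {B α : ℝ} (hf : MemHolder f B α)
    {u v : ℝ} (hu : u ∈ Set.Icc (-B) B) (hv : v ∈ Set.Icc (-B) B) :
    |f u - f v| ≤ holderSeminorm f B α * |u - v| ^ α := by
  rcases eq_or_ne u v with rfl | h
  · rw [sub_self, abs_zero]
    exact mul_nonneg (holderSeminorm_nonneg _ _ _) (Real.rpow_nonneg (abs_nonneg _) _)
  · have h1 : 0 < |u - v| ^ α := Real.rpow_pos_of_pos (abs_pos.2 (sub_ne_zero.2 h)) _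
    exact (div_le_iff₀ h1).1 (le_csSup hf ⟨u, hu, v, hv, h, rfl⟩)

theorem MemHolder.abs_le_supNorm {f : ℝ → ℝ} {B α : ℝ} (hf : MemHolder f B α)
    (hB : 0 ≤ B) (hα : 0 < α) {u : ℝ} (hu : u ∈ Set.Icc (-B) B) : |f u| ≤ supNorm f B := by
  refine le_csSup ⟨|f 0| + holderSeminorm f B α * B ^ α, ?_⟩ ⟨u, hu, rfl⟩
  rintro _ ⟨v, hv, rfl⟩
  have h1 := hf.abs_sub_le hv (v := 0) ⟨by linarith, hB⟩
  have h2 : |v - 0| ^ α ≤ B ^ α :=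
    Real.rpow_le_rpow (abs_nonneg _) (by rw [sub_zero]; exact abs_le.2 hv) hα.le
  have h3 := mul_le_mul_of_nonneg_left h2 (holderSeminorm_nonneg f B α)
  have h4 := abs_sub_abs_le_abs_sub (f v) (f 0)
  dsimp only
  linarith

/-- The metric projection onto `[-B, B]`. -/
def clamp (B t : ℝ) : ℝ := max (-B) (min B t)

theorem clamp_mem {B : ℝ} (hB : 0 ≤ B) (t : ℝ) : clamp B t ∈ Set.Icc (-B) B :=
  ⟨le_max_left _ _, max_le (by linarith) (min_le_left _ _)⟩

theorem abs_clamp_sub_le {B v : ℝ} (hv : v ∈ Set.Icc (-B) B) (t : ℝ) :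
    |clamp B t - v| ≤ |t - v| := by
  obtain ⟨h1, h2⟩ := hv
  have h3 : clamp B v = v := by rw [clamp, min_eq_right h2, max_eq_right h1]
  conv_lhs => rw [← h3]
  refine (abs_max_sub_max_le_max _ _ _ _).trans ?_
  rw [sub_self, abs_zero, max_eq_right (abs_nonneg _)]
  refine (abs_min_sub_min_le_max _ _ _ _).trans ?_
  rw [sub_self, abs_zero, max_eq_right (abs_nonneg _)]

/-! ### Accuracy of the network -/

/-- A ridge representation whose coefficients do not depend on the exponent bound `q`: beyond the
degree of `Q` and the corresponding number of directions, the coefficients vanish. -/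
theorem exists_ridge_representation_forall {d : ℕ} (hd : 0 < d) (Q : MvPolynomial (Fin d) ℝ) :
    ∃ (ξ : ℕ → EuclideanSpace ℝ (Fin d)) (β : ℕ → ℕ → ℝ), (∀ k, ‖ξ k‖ = 1) ∧
      (∀ ℓ k, β ℓ k ≠ 0 → ℓ < Q.totalDegree ∧ k < featureCount d Q.totalDegree) ∧
      ∀ x : EuclideanSpace ℝ (Fin d), MvPolynomial.eval (fun i => x i) Q =
        MvPolynomial.eval (fun _ => 0) Q +
          ∑ k ∈ Finset.range (featureCount d Q.totalDegree), ∑ ℓ ∈ Finset.range Q.totalDegree,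
            β ℓ k * (inner ℝ (ξ k) x) ^ (ℓ + 1) := by
  obtain ⟨ξ, β, hξ, hrep⟩ := exists_ridge_representation hd Q
  refine ⟨fun k => if h : k < featureCount d Q.totalDegree then ξ ⟨k, h⟩
      else EuclideanSpace.single ⟨0, hd⟩ 1,
    fun ℓ k => if h : ℓ < Q.totalDegree ∧ k < featureCount d Q.totalDegree
      then β ℓ ⟨k, h.2⟩ else 0, fun k => ?_, fun ℓ k h => ?_, fun x => ?_⟩
  · dsimp only
    split_ifs
    · exact hξ _
    · simp
  · by_contra h'
    exact h (dif_neg h')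
  · rw [hrep x, Finset.sum_comm, Finset.sum_range]
    congr 1
    refine Finset.sum_congr rfl fun k _ => Finset.sum_congr rfl fun ℓ hℓ => ?_
    simp only [Finset.mem_range.1 hℓ, k.isLt, and_self, dif_pos]

/-- Sums over larger index sets add only vanishing coefficients. -/
theorem sum_fin_eq_sum_range {n n₀ q q₀ : ℕ} (hn : n₀ ≤ n) (hq : q₀ ≤ q) (c : ℕ → ℕ → ℝ)
    (hc : ∀ ℓ k, c ℓ k ≠ 0 → ℓ < q₀ ∧ k < n₀) :
    ∑ k : Fin n, ∑ ℓ : Fin q, c ℓ k =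
      ∑ k ∈ Finset.range n₀, ∑ ℓ ∈ Finset.range q₀, c ℓ k := by
  have h1 : ∀ k, ∑ ℓ : Fin q, c ℓ k = ∑ ℓ ∈ Finset.range q₀, c ℓ k := by
    intro k
    rw [← Finset.sum_range fun ℓ => c ℓ k]
    symm
    refine Finset.sum_subset (Finset.range_mono hq) fun ℓ _ hℓ => ?_
    by_contra h
    exact hℓ (Finset.mem_range.2 (hc _ _ h).1)
  simp only [h1]
  rw [← Finset.sum_range fun k => ∑ ℓ ∈ Finset.range q₀, c ℓ k]
  symm
  refine Finset.sum_subset (Finset.range_mono hn) fun k _ hk => Finset.sum_eq_zero fun ℓ _ => ?_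
  by_contra h
  exact hk (Finset.mem_range.2 (hc _ _ h).2)

theorem ReachesAccuracy.mono {d s q N : ℕ} {Q : MvPolynomial (Fin d) ℝ}
    {Ω : Set (EuclideanSpace ℝ (Fin d))} {f : ℝ → ℝ} {Bhat δ δ' : ℝ} (hδ : δ ≤ δ')
    (h : ReachesAccuracy s q N Q Ω f Bhat δ) : ReachesAccuracy s q N Q Ω f Bhat δ' := by
  refine ⟨h.1, fun w₂ hw₂ => ?_⟩
  obtain ⟨θ, h1, h2, h3⟩ := h.2 w₂ hw₂
  exact ⟨θ, h1, h2, fun x hx => (h3 x hx).trans hδ⟩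

/-- Here `Bhat` dominates every spline approximation of `Q` on the unit ball, and `K / N` is the
error of these approximations. -/
theorem reachesAccuracy_of_ridge {d s q N : ℕ} (hs : 2 ≤ s) (hsd : s ≤ d) (hN : 1 ≤ N)
    (Q : MvPolynomial (Fin d) ℝ) (ξ : Fin (featureCount d q) → EuclideanSpace ℝ (Fin d))
    (β : Fin q → Fin (featureCount d q) → ℝ) (hξ : ∀ k, ‖ξ k‖ = 1)
    (hrep : ∀ x : EuclideanSpace ℝ (Fin d), MvPolynomial.eval (fun i => x i) Q =
      MvPolynomial.eval (fun _ => 0) Q +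
        ∑ k, ∑ ℓ : Fin q, β ℓ k * (inner ℝ (ξ k) x) ^ ((ℓ : ℕ) + 1))
    {Bhat K : ℝ} (hBpos : 0 < Bhat)
    (hBhat : |MvPolynomial.eval (fun _ => 0) Q| + ∑ k, ∑ ℓ : Fin q, |β ℓ k| ≤ Bhat)
    (hK : ∑ k, ∑ ℓ : Fin q, |β ℓ k| * ((ℓ : ℕ) + 1 : ℕ) ≤ K)
    {Ω : Set (EuclideanSpace ℝ (Fin d))} (hΩ : Ω ⊆ Metric.closedBall 0 1) {α : ℝ} (hα : 0 < α)
    {f : ℝ → ℝ} (hf : MemHolder f (polySup Q Ω) α) :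
    ReachesAccuracy s q N Q Ω f Bhat
      ((Bhat + K) ^ α * holderSeminorm f (polySup Q Ω) α / (N : ℝ) ^ α) := by
  refine ⟨exists_spikeFactorization N hs (by omega), fun w₂ hw₂ => ?_⟩
  have hN0 : (0 : ℝ) < N := by exact_mod_cast hN
  have hB0 := polySup_nonneg Q Ω
  have hH0 := holderSeminorm_nonneg f (polySup Q Ω) α
  have hK0 : 0 ≤ K := le_trans (Finset.sum_nonneg fun _ _ => Finset.sum_nonneg fun _ _ =>
    mul_nonneg (abs_nonneg _) (Nat.cast_nonneg _)) hK
  -- The samples are those of `u ↦ f (Bhat * u)`, with `f` extended by constants.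
  obtain ⟨θ, hscale, hconst, hridge, hsample, hnet⟩ := exists_parameters hs hsd w₂ hw₂ ξ β
    (MvPolynomial.eval (fun _ => 0) Q) Bhat
    fun m => f (clamp (polySup Q Ω) (Bhat * (-1 + (m : ℝ) / (N : ℝ))))
  have hcoeff : ∀ i, outCoeff θ i = N / Bhat * secondDiff N
      (fun m => f (clamp (polySup Q Ω) (Bhat * (-1 + (m : ℝ) / (N : ℝ))))) i := by
    intro i
    simp only [outCoeff, hscale, hsample]
  refine ⟨θ, ⟨hscale, hconst, ξ, hξ, fun x => ?_⟩, fun i => ?_, fun x hx => ?_⟩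
  · simp only [hridge]
    exact hrep x
  · have hsup : 0 ≤ supNorm f (polySup Q Ω) :=
      (abs_nonneg _).trans (hf.abs_le_supNorm hB0 hα (clamp_mem hB0 0))
    have h1 := abs_secondDiff_le (N := N) hsup (fun m => hf.abs_le_supNorm hB0 hα
      (clamp_mem hB0 (Bhat * (-1 + (m : ℝ) / (N : ℝ))))) i
    rw [hcoeff, abs_mul, abs_of_pos (div_pos hN0 hBpos)]
    calc N / Bhat * _ ≤ N / Bhat * (4 * supNorm f (polySup Q Ω)) :=
          mul_le_mul_of_nonneg_left h1 (div_pos hN0 hBpos).le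
      _ = 4 * supNorm f (polySup Q Ω) * N / Bhat := by ring
  · have hx1 : ‖x‖ ≤ 1 := by simpa using hΩ hx
    have hQx := abs_le.1 (abs_eval_le_polySup Q hΩ hx)
    have hu : ∀ k, |(inner ℝ (ξ k) x : ℝ)| ≤ 1 := by
      intro k
      refine (abs_real_inner_le_norm _ _).trans ?_
      rw [hξ, one_mul]
      exact hx1
    -- `S ℓ k` is the spline approximation of `(ξ_k · x) ^ (ℓ + 1)`, and `Qt` that of `Q x`.
    set S : Fin q → Fin (featureCount d q) → ℝ := fun ℓ k =>
      ∑ j, N * powerDiff N (ℓ + 1) j * relu (inner ℝ (ξ k) x - knot N j) with hS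
    set Qt : ℝ := MvPolynomial.eval (fun _ => 0) Q + ∑ k, ∑ ℓ : Fin q, β ℓ k * S ℓ k with hQt
    have hQt1 : |Qt| ≤ Bhat := by
      refine (abs_add_le _ _).trans ((add_le_add le_rfl ?_).trans hBhat)
      refine (Finset.abs_sum_le_sum_abs _ _).trans (Finset.sum_le_sum fun k _ => ?_)
      refine (Finset.abs_sum_le_sum_abs _ _).trans (Finset.sum_le_sum fun ℓ _ => ?_)
      rw [abs_mul]
      exact mul_le_of_le_one_right (abs_nonneg _) (abs_spline_pow_le hN _ (hu k))
    have hQt2 : |Qt - MvPolynomial.eval (fun i => x i) Q| ≤ K / N := by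
      rw [hrep x, hQt, add_sub_add_left_eq_sub, ← Finset.sum_sub_distrib]
      refine le_trans ?_ (div_le_div_of_nonneg_right hK hN0.le)
      rw [Finset.sum_div]
      refine (Finset.abs_sum_le_sum_abs _ _).trans (Finset.sum_le_sum fun k _ => ?_)
      rw [← Finset.sum_sub_distrib, Finset.sum_div]
      refine (Finset.abs_sum_le_sum_abs _ _).trans (Finset.sum_le_sum fun ℓ _ => ?_)
      rw [← mul_sub, abs_mul, mul_div_assoc]
      exact mul_le_mul_of_nonneg_left (abs_spline_pow_sub_le hN _ (hu k)) (abs_nonneg _)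
    have hout : ∑ i, outCoeff θ i * (buildNet w₂ θ).lastLayer (fun i => x i) i =
        ∑ i, N * secondDiff N
          (fun m => f (clamp (polySup Q Ω) (Bhat * (-1 + (m : ℝ) / (N : ℝ))))) i *
          relu (Qt / Bhat - knot N i) := by
      refine Finset.sum_congr rfl fun i _ => ?_
      have h1 : Qt - Bhat * knot N i = Bhat * (Qt / Bhat - knot N i) := by
        field_simp
      have h2 : relu (Bhat * (Qt / Bhat - knot N i)) = Bhat * relu (Qt / Bhat - knot N i) := by
        rw [relu, relu, mul_max_of_nonneg _ _ hBpos.le, mul_zero]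
      rw [hnet x hx1, hcoeff]
      change _ * relu (Qt - Bhat * knot N i) = _
      rw [h1, h2]
      field_simp
    rw [hout]
    refine abs_spline_sub_le hN _ ?_ fun m hm => ?_
    · rw [abs_div, abs_of_pos hBpos]
      exact (div_le_one hBpos).2 hQt1
    · refine (hf.abs_sub_le (clamp_mem hB0 _) hQx).trans ?_
      have h1 : |Bhat * (-1 + (m : ℝ) / N) - MvPolynomial.eval (fun i => x i) Q| ≤
          (Bhat + K) / N := by
        have e : Bhat * (-1 + (m : ℝ) / N) - MvPolynomial.eval (fun i => x i) Q =
            -(Bhat * (Qt / Bhat - (-1 + (m : ℝ) / N))) +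
              (Qt - MvPolynomial.eval (fun i => x i) Q) := by
          rw [mul_sub, mul_div_cancel₀ _ hBpos.ne']
          ring
        rw [e, add_div Bhat K]
        refine (abs_add_le _ _).trans (add_le_add ?_ hQt2)
        rw [abs_neg, abs_mul, abs_of_pos hBpos, div_eq_mul_one_div Bhat]
        exact mul_le_mul_of_nonneg_left hm hBpos.le
      have h2 := Real.rpow_le_rpow (abs_nonneg _) ((abs_clamp_sub_le hQx _).trans h1) hα.le
      rw [Real.div_rpow (by linarith) hN0.le] at h2
      calc _ ≤ holderSeminorm f (polySup Q Ω) α * ((Bhat + K) ^ α / (N : ℝ) ^ α) :=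
            mul_le_mul_of_nonneg_left h2 hH0
        _ = _ := by ring

/-! ### Parameters in terms of the accuracy -/

/-- The choice of `N` for which the error bound `A H / N ^ α` is at most `ε`. -/
theorem div_rpow_le_of_ceil {A H ε α : ℝ} {N : ℕ} (hA : 0 ≤ A) (hH : 0 ≤ H) (hε : 0 < ε)
    (hα : 0 < α)
    (hN : N = max 1 ⌈A ^ (1 / α) * H ^ (1 / α) * ε ^ (-(1 / α))⌉₊) :
    A * H / (N : ℝ) ^ α ≤ ε := by
  have hN1 : (0 : ℝ) < N := by
    exact_mod_cast (hN ▸ lt_of_lt_of_le Nat.one_pos (le_max_left _ _) : 0 < N)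
  have h1 : A ^ (1 / α) * H ^ (1 / α) * ε ^ (-(1 / α)) ≤ N := by
    refine (Nat.le_ceil _).trans ?_
    rw [hN]
    exact_mod_cast le_max_right _ _
  have h2 := Real.rpow_le_rpow (by positivity) h1 hα.le
  rw [Real.mul_rpow (by positivity) (by positivity), Real.mul_rpow (by positivity) (by positivity),
    ← Real.rpow_mul hA, ← Real.rpow_mul hH, ← Real.rpow_mul hε.le, neg_mul,
    one_div_mul_cancel hα.ne', Real.rpow_one, Real.rpow_one, Real.rpow_neg_one] at h2
  rw [div_le_iff₀ (Real.rpow_pos_of_pos hN1 _), mul_comm ε]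
  exact (div_le_iff₀ hε).1 h2

/-- The parameter count for `N = max {1, ⌈c E⌉}`, where `E` stands for `ε ^ (-1/α)`. -/
theorem freeCount_le_accuracy {d s q N : ℕ} {c E : ℝ} (hs : 2 ≤ s) (hsd : s ≤ d) (hq : 1 ≤ q)
    (hc : 0 ≤ c) (hE : 1 ≤ E) (hN : N = max 1 ⌈c * E⌉₊) :
    (freeCount d s q N : ℝ) ≤ (43 * (c + 1) + q + 73 + 8 * d) * (d : ℝ) ^ q * E := by
  have h1 : (freeCount d s q N : ℝ) ≤ (30 + 28 * featureCount d q) * N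
      + (8 * d + q + 44) * featureCount d q + 4 * s + 49 := by
    exact_mod_cast freeCount_le (q := q) (N := N) hs hsd
  have hNE : (N : ℝ) ≤ (c + 1) * E := by
    have h2 : ((⌈c * E⌉₊ : ℕ) : ℝ) ≤ c * E + 1 := (Nat.ceil_lt_add_one (by positivity)).le
    rw [hN, Nat.cast_max]
    refine max_le ?_ ?_
    · push_cast
      nlinarith
    · linarith
  have hd2 : (2 : ℝ) ≤ d := by exact_mod_cast hs.trans hsd
  have hsd' : (s : ℝ) ≤ d := by exact_mod_cast hsd
  have hdP : (d : ℝ) ≤ (d : ℝ) ^ q := le_self_pow₀ (by linarith) (by omega)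
  have hnP : (featureCount d q : ℝ) ≤ (d : ℝ) ^ q := by
    exact_mod_cast featureCount_le_pow (q := q) (by omega : 0 < d)
  set P : ℝ := (d : ℝ) ^ q
  have hP2 : 2 ≤ P := hd2.trans hdP
  have h3 : (30 + 28 * (featureCount d q : ℝ)) * N ≤ 43 * P * ((c + 1) * E) :=
    mul_le_mul (by linarith) hNE (Nat.cast_nonneg _) (by positivity)
  have h4 : (8 * (d : ℝ) + q + 44) * featureCount d q ≤ (8 * d + q + 44) * P :=
    mul_le_mul_of_nonneg_left hnP (by positivity)
  have h5 : (8 * (d : ℝ) + q + 73) * P ≤ (8 * d + q + 73) * P * E :=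
    le_mul_of_one_le_right (by positivity) hE
  calc (freeCount d s q N : ℝ) ≤ 43 * P * ((c + 1) * E) + (8 * d + q + 73) * P := by linarith
    _ ≤ 43 * P * ((c + 1) * E) + (8 * d + q + 73) * P * E := by linarith
    _ = _ := by ring

end DCNNApprox

end

theorem theorem1 {d : ℕ} (Q : MvPolynomial (Fin d) ℝ) :
    ∃ (Bhat : ℝ) (C : ℝ → ℝ), 0 < Bhat ∧ (∀ α : ℝ, 0 < α → 0 < C α) ∧
      ∀ (s q : ℕ) (Ω : Set (EuclideanSpace ℝ (Fin d))) (α : ℝ) (f : ℝ → ℝ),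
        2 ≤ s → s ≤ d → 1 ≤ q → Q.totalDegree ≤ q → Ω ⊆ Metric.closedBall 0 1 →
        0 < α → α ≤ 1 → DCNNApprox.MemHolder f (DCNNApprox.polySup Q Ω) α →
        (∀ N : ℕ, 1 ≤ N →
          DCNNApprox.ReachesAccuracy s q N Q Ω f Bhat
            (C α * DCNNApprox.holderSeminorm f (DCNNApprox.polySup Q Ω) α / (N : ℝ) ^ α) ∧
          DCNNApprox.freeCount d s q N ≤
            (30 + 28 * DCNNApprox.featureCount d q) * N
              + (8 * d + q + 44) * DCNNApprox.featureCount d q + 4 * s + 49) ∧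
        (∀ (ε : ℝ) (N : ℕ), 0 < ε → ε ≤ 1 →
          N = max 1 ⌈C α ^ (1 / α) *
            DCNNApprox.holderSeminorm f (DCNNApprox.polySup Q Ω) α ^ (1 / α) *
            ε ^ (-(1 / α))⌉₊ →
          DCNNApprox.ReachesAccuracy s q N Q Ω f Bhat ε ∧
          (DCNNApprox.freeCount d s q N : ℝ) ≤
            (43 * (C α ^ (1 / α) *
                DCNNApprox.holderSeminorm f (DCNNApprox.polySup Q Ω) α ^ (1 / α) + 1)
              + q + 73 + 8 * d) * (d : ℝ) ^ q * ε ^ (-(1 / α))) := by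
  rcases Nat.eq_zero_or_pos d with hd | hd
  · -- For `d = 0` no filter length `s` is admissible.
    refine ⟨1, fun _ => 1, one_pos, fun _ _ => one_pos, ?_⟩
    intro s q Ω α f hs hsd
    omega
  obtain ⟨ξ, β, hξ, hβ, hrep⟩ := DCNNApprox.exists_ridge_representation_forall hd Q
  set b : ℝ := ∑ k ∈ Finset.range (DCNNApprox.featureCount d Q.totalDegree),
    ∑ ℓ ∈ Finset.range Q.totalDegree, |β ℓ k| with hb
  set K : ℝ := ∑ k ∈ Finset.range (DCNNApprox.featureCount d Q.totalDegree),
    ∑ ℓ ∈ Finset.range Q.totalDegree, |β ℓ k| * (ℓ + 1 : ℕ) with hK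
  have hb0 : 0 ≤ b := Finset.sum_nonneg fun _ _ => Finset.sum_nonneg fun _ _ => abs_nonneg _
  have hK0 : 0 ≤ K := Finset.sum_nonneg fun _ _ => Finset.sum_nonneg fun _ _ =>
    mul_nonneg (abs_nonneg _) (Nat.cast_nonneg _)
  -- The summand `1` makes `Bhat` positive also for `Q = 0`.
  set Bhat : ℝ := |MvPolynomial.eval (fun _ => 0) Q| + b + 1 with hBhat
  have hBpos : 0 < Bhat := by positivity
  have hC : ∀ α : ℝ, 0 < (Bhat + K) ^ α := fun α => Real.rpow_pos_of_pos (by linarith) α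
  refine ⟨Bhat, fun α => (Bhat + K) ^ α, hBpos, fun α _ => hC α, ?_⟩
  intro s q Ω α f hs hsd hq hQq hΩ hα _ hf
  have hacc : ∀ N : ℕ, 1 ≤ N → DCNNApprox.ReachesAccuracy s q N Q Ω f Bhat
      ((Bhat + K) ^ α * DCNNApprox.holderSeminorm f (DCNNApprox.polySup Q Ω) α / (N : ℝ) ^ α) := by
    intro N hN
    have hpad := DCNNApprox.sum_fin_eq_sum_range (DCNNApprox.featureCount_mono (d := d) hQq) hQq
    refine DCNNApprox.reachesAccuracy_of_ridge hs hsd hN Q (fun k => ξ k) (fun ℓ k => β ℓ k)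
      (fun k => hξ k) (fun x => ?_) hBpos ?_ ?_ hΩ hα hf
    · rw [hrep x, hpad (fun ℓ k => β ℓ k * (inner ℝ (ξ k) x) ^ (ℓ + 1))
        fun ℓ k h => hβ ℓ k (left_ne_zero_of_mul h)]
    · rw [hpad (fun ℓ k => |β ℓ k|) fun ℓ k h => hβ ℓ k (abs_ne_zero.1 h)]
      linarith
    · rw [hpad (fun ℓ k => |β ℓ k| * (ℓ + 1 : ℕ))
        fun ℓ k h => hβ ℓ k (abs_ne_zero.1 (left_ne_zero_of_mul h))]
  have hH0 := DCNNApprox.holderSeminorm_nonneg f (DCNNApprox.polySup Q Ω) α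
  refine ⟨fun N hN => ⟨hacc N hN, DCNNApprox.freeCount_le hs hsd⟩, fun ε N hε hε1 hN => ⟨?_, ?_⟩⟩
  · exact (hacc N (hN ▸ le_max_left _ _)).mono
      (DCNNApprox.div_rpow_le_of_ceil (hC α).le hH0 hε hα hN)
  · refine DCNNApprox.freeCount_le_accuracy hs hsd hq ?_ ?_ hN
    · exact mul_nonneg (Real.rpow_nonneg (hC α).le _) (Real.rpow_nonneg hH0 _)
    · exact Real.one_le_rpow_of_pos_of_le_one_of_nonpos hε hε1
        (neg_nonpos.2 (one_div_pos.2 hα).le)
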